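/- Let $N\ge 1$, let $\Omega\subset\mathbb R^N$ be a bounded open set (in particular, any bounded domain with smooth boundary), let $Y=(0,1)^N$, and let $\alpha>0$. Let $a,b:\mathbb R^N\to\mathbb R^{N\times N}$ and $c,d,\gamma:\mathbb R^N\to\mathbb R$ be measurable and $Y$-periodic (that is, $f(y+k)=f(y)$ for all $y\in\mathbb R^N$, $k\in\mathbb Z^N$), and suppose that for almost every $y\in Y$ the matrices $a(y)$ and $b(y)$ are symmetric, $$\alpha|\xi|^2\le \xi^Ta(y)\xi\le\alpha^{-1}|\xi|^2,\qquad \alpha|\xi|^2\le \xi^Tb(y)\xi\le\alpha^{-1}|\xi|^2\qquad(\xi\in\mathbb R^N),$$ $\alpha\le c(y)\le\alpha^{-1}$, $\alpha\le d(y)\le\alpha^{-1}$ and $0<\gamma(y)<1$. (Thus necessarily $\alpha\le 1$.) Let $\varepsilon>0$ and write $f_\varepsilon(x)=f(x/\varepsilon)$ for $f=a,b,c,d,\gamma$. All function spaces are complex. Let $H^1_0(\Omega)$ be the closure of $C_c^\infty(\Omega)$ in $H^1(\Omega)$. Let $A_\varepsilon w=-\operatorname{div}(a_\varepsilon\nabla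 w)$ in the weak sense, an unbounded operator in $L^2(\Omega)$ with domain $D(A_\varepsilon)=\{w\in H^1_0(\Omega):\operatorname{div}(a_\varepsilon\nabla w)\in L^2(\Omega)\}$, and define $B_\varepsilon$ in the same way from $b$. Let $A_\varepsilon^{1/2}$ be the nonnegative self-adjoint square root of $A_\varepsilon$. On $H=H^1_0(\Omega)\times L^2(\Omega)\times L^2(\Omega)$ let $$\langle(u,v,\theta),(\tilde u,\tilde v,\tilde\theta)\rangle_\varepsilon=\int_\Omega a_\varepsilon\nabla u\cdot\overline{\nabla\tilde u}\,dx+\int_\Omega c_\varepsilon v\,\overline{\tilde v}\,dx+\int_\Omega d_\varepsilon\theta\,\overline{\tilde\theta}\,dx,\qquad \|U\|_\varepsilon=\langle U,U\rangle_\varepsilon^{1/2},$$ and let $\mathbf A_\varepsilon$ be the operator $$\mathbf A_\varepsilon(u,v,\theta)=\Big(v,\;-\tfrac1{c_\varepsilon}A_\varepsilon u-\tfrac{\gamma_\varepsilon}{c_\varepsilon}\theta,\;\tfrac{\gamma_\varepsilon}{d_\varepsilon}v-\tfrac1{d_\varepsilon}B_\varepsilon\theta\Big),\qquad D(\mathbf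 A_\varepsilon)=D(A_\varepsilon)\times D(A_\varepsilon^{1/2})\times D(B_\varepsilon).$$ Then $D(A_\varepsilon^{1/2})=H^1_0(\Omega)$ (so that $\mathbf A_\varepsilon$ is a well-defined operator in $H$), $\langle\cdot,\cdot\rangle_\varepsilon$ is an inner product that makes $H$ a Hilbert space, and $\mathbf A_\varepsilon$ is the infinitesimal generator of a $C_0$-semigroup of contractions on $(H,\|\cdot\|_\varepsilon)$. -/

import Mathlib

open MeasureTheory Filter Topology TopologicalSpace
open scoped NNReal Distributions ContDiff InnerProductSpace

noncomputable section

/-! ### Lebesgue and Sobolev spaces on an open set `Ω ⊆ ℝ^N`, with complex values -/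

/-- The complex Hilbert space `L²(Ω)`. -/
abbrev L2 {N : ℕ} (Ω : Opens (EuclideanSpace ℝ (Fin N))) : Type :=
  Lp ℂ 2 ((volume : Measure (EuclideanSpace ℝ (Fin N))).restrict Ω)

/-- The complex Hilbert space `L²(Ω)^N`. -/
abbrev L2Vec {N : ℕ} (Ω : Opens (EuclideanSpace ℝ (Fin N))) : Type :=
  Lp (EuclideanSpace ℂ (Fin N)) 2 ((volume : Measure (EuclideanSpace ℝ (Fin N))).restrict Ω)

/-- The partial derivative `∂ᵢφ(x)` of a function on `ℝ^N`. -/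
def partialD {N : ℕ} (i : Fin N) (φ : EuclideanSpace ℝ (Fin N) → ℂ)
    (x : EuclideanSpace ℝ (Fin N)) : ℂ :=
  fderiv ℝ φ x (EuclideanSpace.single i 1)

section helpers

variable {N : ℕ} {Ω : Opens (EuclideanSpace ℝ (Fin N))}

theorem testFunction_memLp (φ : 𝓓(Ω, ℂ)) :
    MemLp φ 2 ((volume : Measure (EuclideanSpace ℝ (Fin N))).restrict Ω) :=
  (φ.continuous.memLp_of_hasCompactSupport φ.hasCompactSupport).restrict _

theorem partialD_memLp (φ : 𝓓(Ω, ℂ)) (i : Fin N) :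
    MemLp (partialD i φ) 2 ((volume : Measure (EuclideanSpace ℝ (Fin N))).restrict Ω) := by
  have hc : Continuous (fderiv ℝ φ) := φ.contDiff.continuous_fderiv (by simp)
  have hs : HasCompactSupport (fderiv ℝ φ) := φ.hasCompactSupport.fderiv ℝ
  have hc' : Continuous (partialD i φ) := hc.clm_apply continuous_const
  have hs' : HasCompactSupport (partialD i φ) :=
    hs.comp_left (g := fun L : EuclideanSpace ℝ (Fin N) →L[ℝ] ℂ =>
      L (EuclideanSpace.single i 1)) rfl
  exact (hc'.memLp_of_hasCompactSupport hs').restrict _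

theorem partialD_add (φ ψ : 𝓓(Ω, ℂ)) (i : Fin N) (x : EuclideanSpace ℝ (Fin N)) :
    partialD i (φ + ψ : 𝓓(Ω, ℂ)) x = partialD i φ x + partialD i ψ x := by
  have h1 : DifferentiableAt ℝ φ x := φ.contDiff.differentiable (by simp) x
  have h2 : DifferentiableAt ℝ ψ x := ψ.contDiff.differentiable (by simp) x
  have : ((φ + ψ : 𝓓(Ω, ℂ)) : EuclideanSpace ℝ (Fin N) → ℂ) = φ + ψ := rfl
  simp [partialD, this, fderiv_add h1 h2]

theorem partialD_smul (z : ℂ) (φ : 𝓓(Ω, ℂ)) (i : Fin N) (x : EuclideanSpace ℝ (Fin N)) :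
    partialD i (z • φ : 𝓓(Ω, ℂ)) x = z * partialD i φ x := by
  have h1 : DifferentiableAt ℝ φ x := φ.contDiff.differentiable (by simp) x
  have : ((z • φ : 𝓓(Ω, ℂ)) : EuclideanSpace ℝ (Fin N) → ℂ) = z • ⇑φ := rfl
  simp [partialD, this, fderiv_const_smul h1 z]

theorem L2Vec.coord_memLp (G : L2Vec Ω) (i : Fin N) :
    MemLp (fun x => G x i) 2 ((volume : Measure (EuclideanSpace ℝ (Fin N))).restrict Ω) :=
  (EuclideanSpace.proj (𝕜 := ℂ) i).comp_memLp' (Lp.memLp G)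

theorem integrable_mul_test (u : L2 Ω) (φ : 𝓓(Ω, ℂ)) :
    IntegrableOn (fun x => u x * φ x) Ω :=
  (Lp.memLp u).integrable_mul (testFunction_memLp φ)

theorem integrable_mul_partialD (u : L2 Ω) (φ : 𝓓(Ω, ℂ)) (i : Fin N) :
    IntegrableOn (fun x => u x * partialD i φ x) Ω :=
  (Lp.memLp u).integrable_mul (partialD_memLp φ i)

theorem integrable_coord_mul_test (G : L2Vec Ω) (φ : 𝓓(Ω, ℂ)) (i : Fin N) :
    IntegrableOn (fun x => G x i * φ x) Ω :=
  (G.coord_memLp i).integrable_mul (testFunction_memLp φ)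

theorem integrable_coord_mul_partialD (G : L2Vec Ω) (φ : 𝓓(Ω, ℂ)) (i : Fin N) :
    IntegrableOn (fun x => G x i * partialD i φ x) Ω :=
  (G.coord_memLp i).integrable_mul (partialD_memLp φ i)

theorem ae_eq_zero_of_test {f : EuclideanSpace ℝ (Fin N) → ℂ}
    (hf : MemLp f 2 ((volume : Measure (EuclideanSpace ℝ (Fin N))).restrict Ω))
    (h : ∀ φ : 𝓓(Ω, ℂ), ∫ x in Ω, f x * φ x = 0) :
    f =ᵐ[(volume : Measure (EuclideanSpace ℝ (Fin N))).restrict Ω] 0 := by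
  have hloc : LocallyIntegrableOn f Ω volume :=
    (locallyIntegrableOn_of_locallyIntegrable_restrict (hf.locallyIntegrable (by norm_num)))
  have key := Ω.isOpen.ae_eq_zero_of_integral_contDiff_smul_eq_zero hloc (by
    intro g hg hgc hgs
    have hsub : tsupport (fun x => (g x : ℂ)) ⊆ tsupport g :=
      closure_mono (fun x hx => by
        simp only [Function.mem_support, ne_eq, Complex.ofReal_eq_zero] at hx ⊢; exact hx)
    let φ : 𝓓(Ω, ℂ) :=
      ⟨fun x => (g x : ℂ), Complex.ofRealCLM.contDiff.comp hg,
        hgc.comp_left (g := fun r : ℝ => (r : ℂ)) (by simp), hsub.trans hgs⟩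
    have := h φ
    rw [setIntegral_eq_integral_of_forall_compl_eq_zero] at this
    · rw [← this]
      refine integral_congr_ae (Eventually.of_forall fun x => ?_)
      change g x • f x = f x * (g x : ℂ)
      rw [Complex.real_smul, mul_comm]
    · intro x hx
      have : g x = 0 := by
        by_contra hne
        exact hx (hgs (subset_tsupport g hne))
      change f x * (g x : ℂ) = 0
      simp [this])
  rw [EventuallyEq, ae_restrict_iff' Ω.isOpen.measurableSet]
  exact key

theorem L2.zero_ae : ∀ᵐ x ∂(volume : Measure (EuclideanSpace ℝ (Fin N))).restrict Ω,
    (0 : L2 Ω) x = 0 := by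
  filter_upwards [Lp.coeFn_zero ℂ 2 (volume.restrict (Ω : Set (EuclideanSpace ℝ (Fin N))))]
    with x hx
  rw [hx]; rfl

theorem L2.add_ae (u v : L2 Ω) : ∀ᵐ x ∂(volume : Measure (EuclideanSpace ℝ (Fin N))).restrict Ω,
    (u + v) x = u x + v x := by
  filter_upwards [Lp.coeFn_add u v] with x hx
  rw [hx]; rfl

theorem L2.smul_ae (z : ℂ) (u : L2 Ω) :
    ∀ᵐ x ∂(volume : Measure (EuclideanSpace ℝ (Fin N))).restrict Ω, (z • u) x = z * u x := by
  filter_upwards [Lp.coeFn_smul z u] with x hx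
  rw [hx]; rfl

theorem L2Vec.zero_ae : ∀ᵐ x ∂(volume : Measure (EuclideanSpace ℝ (Fin N))).restrict Ω,
    ∀ i, (0 : L2Vec Ω) x i = 0 := by
  filter_upwards [Lp.coeFn_zero (EuclideanSpace ℂ (Fin N)) 2
    (volume.restrict (Ω : Set (EuclideanSpace ℝ (Fin N))))] with x hx i
  rw [hx]; rfl

theorem L2Vec.add_ae (G H : L2Vec Ω) :
    ∀ᵐ x ∂(volume : Measure (EuclideanSpace ℝ (Fin N))).restrict Ω,
      ∀ i, (G + H) x i = G x i + H x i := by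
  filter_upwards [Lp.coeFn_add G H] with x hx i
  rw [hx]; rfl

theorem L2Vec.smul_ae (z : ℂ) (G : L2Vec Ω) :
    ∀ᵐ x ∂(volume : Measure (EuclideanSpace ℝ (Fin N))).restrict Ω,
      ∀ i, (z • G) x i = z * G x i := by
  filter_upwards [Lp.coeFn_smul z G] with x hx i
  rw [hx]; rfl

end helpers

/-- The graph of the weak gradient in `L²(Ω) × L²(Ω)^N`: the pairs `(u, G)` with
`∫_Ω u ∂ᵢφ = - ∫_Ω Gᵢ φ` for all `φ ∈ C_c^∞(Ω)` and all `i`. -/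
def weakGradGraph {N : ℕ} (Ω : Opens (EuclideanSpace ℝ (Fin N))) :
    Submodule ℂ (L2 Ω × L2Vec Ω) where
  carrier := {p | ∀ (φ : 𝓓(Ω, ℂ)) (i : Fin N),
    ∫ x in Ω, p.1 x * partialD i φ x = - ∫ x in Ω, p.2 x i * φ x}
  zero_mem' := by
    intro φ i
    have h1 : (fun x => (0 : L2 Ω) x * partialD i φ x) =ᵐ[volume.restrict Ω] fun _ => 0 := by
      filter_upwards [L2.zero_ae (Ω := Ω)]
        with x hx
      simp only [hx, zero_mul]
    have h2 : (fun x => (0 : L2Vec Ω) x i * φ x) =ᵐ[volume.restrict Ω] fun _ => 0 := by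
      filter_upwards [L2Vec.zero_ae (Ω := Ω)] with x hx
      simp only [hx, zero_mul]
    simp only [Prod.fst_zero, Prod.snd_zero]
    rw [integral_congr_ae h1, integral_congr_ae h2]
    simp
  add_mem' := by
    rintro ⟨u, G⟩ ⟨u', G'⟩ h h' φ i
    have h1 : (fun x => (u + u') x * partialD i φ x) =ᵐ[volume.restrict Ω]
        fun x => u x * partialD i φ x + u' x * partialD i φ x := by
      filter_upwards [L2.add_ae u u'] with x hx
      simp only [hx, add_mul]
    have h2 : (fun x => (G + G') x i * φ x) =ᵐ[volume.restrict Ω]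
        fun x => G x i * φ x + G' x i * φ x := by
      filter_upwards [L2Vec.add_ae G G'] with x hx
      simp only [hx, add_mul]
    have e1 := h φ i
    have e2 := h' φ i
    simp only [Prod.mk_add_mk] at e1 e2 ⊢
    rw [integral_congr_ae h1, integral_congr_ae h2,
      integral_add (integrable_mul_partialD u φ i) (integrable_mul_partialD u' φ i),
      integral_add (integrable_coord_mul_test G φ i) (integrable_coord_mul_test G' φ i), e1, e2]
    ring
  smul_mem' := by
    rintro z ⟨u, G⟩ h φ i
    have h1 : (fun x => (z • u) x * partialD i φ x) =ᵐ[volume.restrict Ω]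
        fun x => z * (u x * partialD i φ x) := by
      filter_upwards [L2.smul_ae z u] with x hx
      simp only [hx, mul_assoc]
    have h2 : (fun x => (z • G) x i * φ x) =ᵐ[volume.restrict Ω]
        fun x => z * (G x i * φ x) := by
      filter_upwards [L2Vec.smul_ae z G] with x hx
      simp only [hx, mul_assoc]
    have e1 := h φ i
    simp only [Prod.smul_mk] at e1 ⊢
    rw [integral_congr_ae h1, integral_congr_ae h2, integral_const_mul, integral_const_mul, e1]
    ring

theorem weakGradGraph_unique {N : ℕ} {Ω : Opens (EuclideanSpace ℝ (Fin N))}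
    (p : L2 Ω × L2Vec Ω) (hp : p ∈ weakGradGraph Ω) (h0 : p.1 = 0) : p.2 = 0 := by
  obtain ⟨u, G⟩ := p
  simp only at h0
  subst h0
  have hz : ∀ i : Fin N, (fun x => G x i) =ᵐ[volume.restrict Ω] 0 := by
    intro i
    refine ae_eq_zero_of_test (G.coord_memLp i) fun φ => ?_
    have h := hp φ i
    have h1 : (fun x => (0 : L2 Ω) x * partialD i φ x) =ᵐ[volume.restrict Ω] fun _ => 0 := by
      filter_upwards [L2.zero_ae (Ω := Ω)]
        with x hx
      simp only [hx, zero_mul]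
    simp only at h
    rw [integral_congr_ae h1] at h
    simpa using h.symm
  refine (Lp.eq_zero_iff_ae_eq_zero).2 ?_
  filter_upwards [ae_all_iff.2 hz] with x hx
  ext i
  simpa using hx i

/-- The weak gradient `u ↦ ∇u`, an unbounded operator from `L²(Ω)` to `L²(Ω)^N`.
Its domain is the Sobolev space `H¹(Ω)`. -/
def weakGradient {N : ℕ} (Ω : Opens (EuclideanSpace ℝ (Fin N))) : L2 Ω →ₗ.[ℂ] L2Vec Ω :=
  (weakGradGraph Ω).toLinearPMap

/-- The Sobolev space `H¹(Ω)`, as a subspace of `L²(Ω)`. -/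
def sobolevH1 {N : ℕ} (Ω : Opens (EuclideanSpace ℝ (Fin N))) : Submodule ℂ (L2 Ω) :=
  (weakGradient Ω).domain

open Classical in
/-- The weak gradient `∇u` of `u ∈ H¹(Ω)` (and `0` for other `u`). -/
def grad {N : ℕ} {Ω : Opens (EuclideanSpace ℝ (Fin N))} (u : L2 Ω) : L2Vec Ω :=
  if h : u ∈ sobolevH1 Ω then weakGradient Ω ⟨u, h⟩ else 0

/-- The pairs `(φ, ∇φ)` in `L²(Ω) × L²(Ω)^N` with `φ ∈ C_c^∞(Ω)`. -/
def testGraph {N : ℕ} (Ω : Opens (EuclideanSpace ℝ (Fin N))) :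
    Submodule ℂ (L2 Ω × L2Vec Ω) where
  carrier := {p | ∃ φ : 𝓓(Ω, ℂ), (∀ᵐ x ∂volume.restrict Ω, p.1 x = φ x) ∧
    ∀ᵐ x ∂volume.restrict Ω, ∀ i, p.2 x i = partialD i φ x}
  zero_mem' := by
    refine ⟨0, ?_, ?_⟩
    · filter_upwards [L2.zero_ae (Ω := Ω)]
        with x hx
      simp only [Prod.fst_zero, hx]; rfl
    · filter_upwards [L2Vec.zero_ae (Ω := Ω)] with x hx i
      have := partialD_smul 0 (0 : 𝓓(Ω, ℂ)) i x
      rw [zero_smul, zero_mul] at this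
      simp only [Prod.snd_zero, hx, this]
  add_mem' := by
    rintro ⟨u, G⟩ ⟨u', G'⟩ ⟨φ, h1, h2⟩ ⟨ψ, h3, h4⟩
    refine ⟨φ + ψ, ?_, ?_⟩
    · filter_upwards [L2.add_ae u u', h1, h3] with x hx hx1 hx3
      change (u + u') x = φ x + ψ x
      rw [hx, hx1, hx3]
    · filter_upwards [L2Vec.add_ae G G', h2, h4] with x hx hx2 hx4 i
      have e2 := hx2 i
      have e4 := hx4 i
      change (G + G') x i = _
      rw [hx, e2, e4, partialD_add]
  smul_mem' := by
    rintro z ⟨u, G⟩ ⟨φ, h1, h2⟩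
    refine ⟨z • φ, ?_, ?_⟩
    · filter_upwards [L2.smul_ae z u, h1] with x hx hx1
      change (z • u) x = z * φ x
      rw [hx, hx1]
    · filter_upwards [L2Vec.smul_ae z G, h2] with x hx hx2 i
      have e2 := hx2 i
      change (z • G) x i = _
      rw [hx, e2, partialD_smul]

/-- The Sobolev space `H¹₀(Ω)`: the closure of `C_c^∞(Ω)` in `H¹(Ω)`, as a subspace of `L²(Ω)`.
That is, `u ∈ H¹₀(Ω)` iff there are `G` and `φₙ ∈ C_c^∞(Ω)` with `φₙ → u` and `∇φₙ → G` in `L²`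
(and then `G` is the weak gradient of `u`). -/
def sobolevH10 {N : ℕ} (Ω : Opens (EuclideanSpace ℝ (Fin N))) : Submodule ℂ (L2 Ω) :=
  (testGraph Ω).topologicalClosure.map (LinearMap.fst ℂ (L2 Ω) (L2Vec Ω))

/-! ### Periodic coefficients -/

/-- The periodicity cell `Y = (0,1)^N`. -/
def unitCell (N : ℕ) : Set (EuclideanSpace ℝ (Fin N)) :=
  {y | ∀ i, y i ∈ Set.Ioo (0 : ℝ) 1}

/-- `Y`-periodicity: `f(y + k) = f(y)` for all `k ∈ ℤ^N`. -/
def IsCellPeriodic {N : ℕ} {β : Type*} (f : EuclideanSpace ℝ (Fin N) → β) : Prop :=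
  ∀ (k : Fin N → ℤ) (y : EuclideanSpace ℝ (Fin N)),
    f (y + WithLp.toLp 2 fun i => (k i : ℝ)) = f y

/-- `a` is a measurable `Y`-periodic field of symmetric matrices with
`α|ξ|² ≤ ξᵀ a(y) ξ ≤ α⁻¹|ξ|²` for almost every `y ∈ Y` and all `ξ ∈ ℝ^N`. -/
structure IsEllipticCoeff {N : ℕ} (α : ℝ)
    (a : EuclideanSpace ℝ (Fin N) → Matrix (Fin N) (Fin N) ℝ) : Prop where
  measurable : ∀ i j, Measurable fun y => a y i j
  periodic : IsCellPeriodic a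
  symm : ∀ᵐ y ∂volume.restrict (unitCell N), (a y).IsSymm
  lower : ∀ᵐ y ∂volume.restrict (unitCell N), ∀ ξ : Fin N → ℝ,
    α * (∑ i, ξ i ^ 2) ≤ ∑ i, ∑ j, ξ i * a y i j * ξ j
  upper : ∀ᵐ y ∂volume.restrict (unitCell N), ∀ ξ : Fin N → ℝ,
    ∑ i, ∑ j, ξ i * a y i j * ξ j ≤ α⁻¹ * (∑ i, ξ i ^ 2)

/-- `c` is a measurable `Y`-periodic function with `α ≤ c(y) ≤ α⁻¹` for almost every `y ∈ Y`. -/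
structure IsDensityCoeff {N : ℕ} (α : ℝ) (c : EuclideanSpace ℝ (Fin N) → ℝ) : Prop where
  measurable : Measurable c
  periodic : IsCellPeriodic c
  bounds : ∀ᵐ y ∂volume.restrict (unitCell N), α ≤ c y ∧ c y ≤ α⁻¹

/-- `γ` is a measurable `Y`-periodic function with `0 < γ(y) < 1` for almost every `y ∈ Y`. -/
structure IsCouplingCoeff {N : ℕ} (γ : EuclideanSpace ℝ (Fin N) → ℝ) : Prop where
  measurable : Measurable γ
  periodic : IsCellPeriodic γ
  bounds : ∀ᵐ y ∂volume.restrict (unitCell N), 0 < γ y ∧ γ y < 1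

/-! ### The elliptic operators -/

/-- The graph of `A_ε w = -div(a(·/ε)∇w)` in `L²(Ω)` with Dirichlet boundary condition: the pairs
`(w, f)` with `w ∈ H¹₀(Ω)` whose flux `σ = a(·/ε)∇w` lies in `L²(Ω)^N` and satisfies
`-div σ = f` weakly, i.e. `∫_Ω σ·∇φ = ∫_Ω f φ` for all `φ ∈ C_c^∞(Ω)`. -/
def ellipticGraph {N : ℕ} (Ω : Opens (EuclideanSpace ℝ (Fin N))) (ε : ℝ)
    (a : EuclideanSpace ℝ (Fin N) → Matrix (Fin N) (Fin N) ℝ) : Submodule ℂ (L2 Ω × L2 Ω) where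
  carrier := {p | p.1 ∈ sobolevH10 Ω ∧ ∃ G σ : L2Vec Ω, (p.1, G) ∈ weakGradGraph Ω ∧
    (∀ᵐ x ∂volume.restrict Ω, ∀ i, σ x i = ∑ j, (a (ε⁻¹ • x) i j : ℂ) * G x j) ∧
    ∀ φ : 𝓓(Ω, ℂ), ∫ x in Ω, ∑ i, σ x i * partialD i φ x = ∫ x in Ω, p.2 x * φ x}
  zero_mem' := by
    refine ⟨Submodule.zero_mem _, 0, 0, Submodule.zero_mem _, ?_, fun φ => ?_⟩
    · filter_upwards [L2Vec.zero_ae (Ω := Ω)] with x hx i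
      simp only [hx, mul_zero, Finset.sum_const_zero]
    · have h1 : (fun x => ∑ i, (0 : L2Vec Ω) x i * partialD i φ x) =ᵐ[volume.restrict Ω]
          fun _ => 0 := by
        filter_upwards [L2Vec.zero_ae (Ω := Ω)] with x hx
        simp only [hx, zero_mul, Finset.sum_const_zero]
      have h2 : (fun x => (0 : L2 Ω) x * φ x) =ᵐ[volume.restrict Ω] fun _ => 0 := by
        filter_upwards [L2.zero_ae (Ω := Ω)]
          with x hx
        simp only [hx, zero_mul]
      simp only [Prod.snd_zero]
      rw [integral_congr_ae h1, integral_congr_ae h2]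
  add_mem' := by
    rintro ⟨u, f⟩ ⟨u', f'⟩ ⟨hu, G, σ, hG, hσ, h⟩ ⟨hu', G', σ', hG', hσ', h'⟩
    refine ⟨Submodule.add_mem _ hu hu', G + G', σ + σ', Submodule.add_mem _ hG hG', ?_,
      fun φ => ?_⟩
    · filter_upwards [L2Vec.add_ae G G', L2Vec.add_ae σ σ', hσ, hσ'] with x hx hy h1 h2 i
      simp only [hx, hy, h1 i, h2 i, mul_add, Finset.sum_add_distrib]
    · have h1 : (fun x => ∑ i, (σ + σ') x i * partialD i φ x) =ᵐ[volume.restrict Ω]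
          fun x => (∑ i, σ x i * partialD i φ x) + ∑ i, σ' x i * partialD i φ x := by
        filter_upwards [L2Vec.add_ae σ σ'] with x hx
        simp only [hx, add_mul, Finset.sum_add_distrib]
      have h2 : (fun x => (f + f') x * φ x) =ᵐ[volume.restrict Ω]
          fun x => f x * φ x + f' x * φ x := by
        filter_upwards [L2.add_ae f f'] with x hx
        simp only [hx, add_mul]
      have e1 := h φ
      have e2 := h' φ
      simp only [Prod.mk_add_mk] at e1 e2 ⊢
      rw [integral_congr_ae h1, integral_congr_ae h2,
        integral_add (integrable_finsetSum _ fun i _ => integrable_coord_mul_partialD σ φ i)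
          (integrable_finsetSum _ fun i _ => integrable_coord_mul_partialD σ' φ i),
        integral_add (integrable_mul_test f φ) (integrable_mul_test f' φ), e1, e2]
  smul_mem' := by
    rintro z ⟨u, f⟩ ⟨hu, G, σ, hG, hσ, h⟩
    refine ⟨Submodule.smul_mem _ z hu, z • G, z • σ, Submodule.smul_mem _ z hG, ?_, fun φ => ?_⟩
    · filter_upwards [L2Vec.smul_ae z G, L2Vec.smul_ae z σ, hσ] with x hx hy h1 i
      simp only [hx, hy, h1 i, Finset.mul_sum, mul_left_comm]
    · have h1 : (fun x => ∑ i, (z • σ) x i * partialD i φ x) =ᵐ[volume.restrict Ω]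
          fun x => z * ∑ i, σ x i * partialD i φ x := by
        filter_upwards [L2Vec.smul_ae z σ] with x hx
        simp only [hx, mul_assoc, Finset.mul_sum]
      have h2 : (fun x => (z • f) x * φ x) =ᵐ[volume.restrict Ω]
          fun x => z * (f x * φ x) := by
        filter_upwards [L2.smul_ae z f] with x hx
        simp only [hx, mul_assoc]
      have e1 := h φ
      simp only [Prod.smul_mk] at e1 ⊢
      rw [integral_congr_ae h1, integral_congr_ae h2, integral_const_mul, integral_const_mul, e1]

theorem ellipticGraph_unique {N : ℕ} {Ω : Opens (EuclideanSpace ℝ (Fin N))} {ε : ℝ}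
    {a : EuclideanSpace ℝ (Fin N) → Matrix (Fin N) (Fin N) ℝ}
    (p : L2 Ω × L2 Ω) (hp : p ∈ ellipticGraph Ω ε a) (h0 : p.1 = 0) : p.2 = 0 := by
  obtain ⟨u, f⟩ := p
  obtain ⟨-, G, σ, hG, hσ, h⟩ := hp
  have hG0 : G = 0 := weakGradGraph_unique _ hG h0
  refine (Lp.eq_zero_iff_ae_eq_zero).2 (ae_eq_zero_of_test (Lp.memLp f) fun φ => ?_)
  have h1 : (fun x => ∑ i, σ x i * partialD i φ x) =ᵐ[volume.restrict Ω] fun _ => 0 := by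
    filter_upwards [hσ, L2Vec.zero_ae (Ω := Ω)] with x hx hx0
    simp only [hx, hG0, hx0, mul_zero, zero_mul, Finset.sum_const_zero]
  have e := h φ
  rw [integral_congr_ae h1] at e
  simpa using e.symm

/-- The operator `w ↦ -div(a(·/ε)∇w)` in `L²(Ω)` with Dirichlet boundary condition. -/
def ellipticOp {N : ℕ} (Ω : Opens (EuclideanSpace ℝ (Fin N))) (ε : ℝ)
    (a : EuclideanSpace ℝ (Fin N) → Matrix (Fin N) (Fin N) ℝ) : L2 Ω →ₗ.[ℂ] L2 Ω :=
  (ellipticGraph Ω ε a).toLinearPMap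

/-- `S` is a nonnegative self-adjoint square root of the unbounded operator `A`: `S` is
self-adjoint and nonnegative, and `S ∘ S = A`, domains included. -/
structure IsNonnegSqrt {X : Type*} [NormedAddCommGroup X] [InnerProductSpace ℂ X] [CompleteSpace X]
    (A S : X →ₗ.[ℂ] X) : Prop where
  selfAdjoint : IsSelfAdjoint S
  nonneg : ∀ x : S.domain, 0 ≤ (⟪S x, (x : X)⟫_ℂ).re
  sq : ∀ x y : X, (x, y) ∈ A.graph ↔ ∃ z, (x, z) ∈ S.graph ∧ (z, y) ∈ S.graph

open Classical in
/-- `D(A^{1/2})`, the domain of the nonnegative self-adjoint square root of `A`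
(and `0` if `A` has no such root). -/
def sqrtDomain {X : Type*} [NormedAddCommGroup X] [InnerProductSpace ℂ X] [CompleteSpace X]
    (A : X →ₗ.[ℂ] X) : Submodule ℂ X :=
  if h : ∃ S, IsNonnegSqrt A S then h.choose.domain else ⊥

/-! ### The energy space and the thermoelastic operator -/

/-- The vector space `H = H¹₀(Ω) × L²(Ω) × L²(Ω)`, with no norm chosen. -/
def EnergySpace {N : ℕ} (Ω : Opens (EuclideanSpace ℝ (Fin N))) : Type :=
  sobolevH10 Ω × L2 Ω × L2 Ω

instance {N : ℕ} (Ω : Opens (EuclideanSpace ℝ (Fin N))) : AddCommGroup (EnergySpace Ω) :=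
  inferInstanceAs (AddCommGroup (sobolevH10 Ω × L2 Ω × L2 Ω))

instance {N : ℕ} (Ω : Opens (EuclideanSpace ℝ (Fin N))) : Module ℂ (EnergySpace Ω) :=
  inferInstanceAs (Module ℂ (sobolevH10 Ω × L2 Ω × L2 Ω))

namespace EnergySpace

variable {N : ℕ} {Ω : Opens (EuclideanSpace ℝ (Fin N))}

/-- The displacement `u` of a state `(u, v, θ)`. -/
def disp : EnergySpace Ω →ₗ[ℂ] L2 Ω :=
  (sobolevH10 Ω).subtype ∘ₗ LinearMap.fst ℂ (sobolevH10 Ω) (L2 Ω × L2 Ω)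

/-- The velocity `v` of a state `(u, v, θ)`. -/
def vel : EnergySpace Ω →ₗ[ℂ] L2 Ω :=
  LinearMap.fst ℂ (L2 Ω) (L2 Ω) ∘ₗ LinearMap.snd ℂ (sobolevH10 Ω) (L2 Ω × L2 Ω)

/-- The temperature `θ` of a state `(u, v, θ)`. -/
def temp : EnergySpace Ω →ₗ[ℂ] L2 Ω :=
  LinearMap.snd ℂ (L2 Ω) (L2 Ω) ∘ₗ LinearMap.snd ℂ (sobolevH10 Ω) (L2 Ω × L2 Ω)

end EnergySpace

/-- The energy inner product
`⟨(u,v,θ), (u',v',θ')⟩_ε = ∫_Ω a_ε ∇u · conj ∇u' + ∫_Ω c_ε v conj v' + ∫_Ω d_ε θ conj θ'`,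
where `a_ε(x) = a(x/ε)` and so on; it is linear in the first argument. -/
def energyForm {N : ℕ} (Ω : Opens (EuclideanSpace ℝ (Fin N))) (ε : ℝ)
    (a : EuclideanSpace ℝ (Fin N) → Matrix (Fin N) (Fin N) ℝ)
    (c d : EuclideanSpace ℝ (Fin N) → ℝ) (U V : EnergySpace Ω) : ℂ :=
  (∫ x in Ω, ∑ i, ∑ j, (a (ε⁻¹ • x) i j : ℂ) * grad U.disp x j *
      starRingEnd ℂ (grad V.disp x i)) +
    (∫ x in Ω, (c (ε⁻¹ • x) : ℂ) * U.vel x * starRingEnd ℂ (V.vel x)) +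
    ∫ x in Ω, (d (ε⁻¹ • x) : ℂ) * U.temp x * starRingEnd ℂ (V.temp x)

/-- The graph of the thermoelastic operator
`(u, v, θ) ↦ (v, -(1/c_ε) A_ε u - (γ_ε/c_ε) θ, (γ_ε/d_ε) v - (1/d_ε) B_ε θ)` in `H`, on the domain
`u ∈ D(A_ε)`, `v ∈ D(A_ε^{1/2})`, `θ ∈ D(B_ε)`, where `A_ε w = -div(a(·/ε)∇w)` and
`B_ε w = -div(b(·/ε)∇w)`. -/
def thermoGraph {N : ℕ} (Ω : Opens (EuclideanSpace ℝ (Fin N))) (ε : ℝ)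
    (a b : EuclideanSpace ℝ (Fin N) → Matrix (Fin N) (Fin N) ℝ)
    (c d γ : EuclideanSpace ℝ (Fin N) → ℝ) : Submodule ℂ (EnergySpace Ω × EnergySpace Ω) where
  carrier := {p | ∃ Au Bθ : L2 Ω,
    (p.1.disp, Au) ∈ (ellipticOp Ω ε a).graph ∧
    p.1.vel ∈ sqrtDomain (ellipticOp Ω ε a) ∧
    (p.1.temp, Bθ) ∈ (ellipticOp Ω ε b).graph ∧
    p.2.disp = p.1.vel ∧
    (∀ᵐ x ∂volume.restrict Ω, p.2.vel x =
      -(1 / (c (ε⁻¹ • x) : ℂ)) * Au x - (γ (ε⁻¹ • x) : ℂ) / (c (ε⁻¹ • x) : ℂ) * p.1.temp x) ∧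
    (∀ᵐ x ∂volume.restrict Ω, p.2.temp x =
      (γ (ε⁻¹ • x) : ℂ) / (d (ε⁻¹ • x) : ℂ) * p.1.vel x - (1 / (d (ε⁻¹ • x) : ℂ)) * Bθ x)}
  zero_mem' := by
    refine ⟨0, 0, ?_, ?_, ?_, ?_, ?_, ?_⟩
    · simp
    · simp
    · simp
    · simp
    all_goals
      filter_upwards [L2.zero_ae (Ω := Ω)] with x hx
      simp only [Prod.fst_zero, Prod.snd_zero, map_zero, hx, mul_zero, sub_zero]
  add_mem' := by
    rintro ⟨U, F⟩ ⟨U', F'⟩ ⟨w, q, h1, h2, h3, h4, h5, h6⟩ ⟨w', q', h1', h2', h3', h4', h5', h6'⟩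
    refine ⟨w + w', q + q', ?_, ?_, ?_, ?_, ?_, ?_⟩
    · simpa using Submodule.add_mem _ h1 h1'
    · simpa using Submodule.add_mem _ h2 h2'
    · simpa using Submodule.add_mem _ h3 h3'
    · simp only at h4 h4'
      simp [h4, h4']
    · filter_upwards [h5, h5', L2.add_ae w w', L2.add_ae U.temp U'.temp,
        L2.add_ae F.vel F'.vel] with x e e' e1 e2 e3
      simp only [Prod.mk_add_mk, map_add] at e e' ⊢
      rw [e3, e2, e1]
      rw [e, e']
      ring
    · filter_upwards [h6, h6', L2.add_ae q q', L2.add_ae U.vel U'.vel,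
        L2.add_ae F.temp F'.temp] with x e e' e1 e2 e3
      simp only [Prod.mk_add_mk, map_add] at e e' ⊢
      rw [e3, e2, e1]
      rw [e, e']
      ring
  smul_mem' := by
    rintro z ⟨U, F⟩ ⟨w, q, h1, h2, h3, h4, h5, h6⟩
    refine ⟨z • w, z • q, ?_, ?_, ?_, ?_, ?_, ?_⟩
    · simpa using Submodule.smul_mem _ z h1
    · simpa using Submodule.smul_mem _ z h2
    · simpa using Submodule.smul_mem _ z h3
    · simp only at h4
      simp [h4]
    · filter_upwards [h5, L2.smul_ae z w, L2.smul_ae z U.temp,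
        L2.smul_ae z F.vel] with x e e1 e2 e3
      simp only [Prod.smul_mk, map_smul] at e ⊢
      rw [e3, e2, e1]
      rw [e]
      ring
    · filter_upwards [h6, L2.smul_ae z q, L2.smul_ae z U.vel,
        L2.smul_ae z F.temp] with x e e1 e2 e3
      simp only [Prod.smul_mk, map_smul] at e ⊢
      rw [e3, e2, e1]
      rw [e]
      ring

theorem thermoGraph_unique {N : ℕ} {Ω : Opens (EuclideanSpace ℝ (Fin N))} {ε : ℝ}
    {a b : EuclideanSpace ℝ (Fin N) → Matrix (Fin N) (Fin N) ℝ}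
    {c d γ : EuclideanSpace ℝ (Fin N) → ℝ} (p : EnergySpace Ω × EnergySpace Ω)
    (hp : p ∈ thermoGraph Ω ε a b c d γ) (h0 : p.1 = 0) : p.2 = 0 := by
  obtain ⟨U, F⟩ := p
  obtain ⟨w, q, h1, -, h3, h4, h5, h6⟩ := hp
  simp only at h0
  subst h0
  have hw : w = 0 := by
    rw [ellipticOp, Submodule.toLinearPMap_graph_eq _ ellipticGraph_unique] at h1
    exact ellipticGraph_unique _ h1 (by simp)
  have hq : q = 0 := by
    rw [ellipticOp, Submodule.toLinearPMap_graph_eq _ ellipticGraph_unique] at h3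
    exact ellipticGraph_unique _ h3 (by simp)
  have hz := L2.zero_ae (Ω := Ω)
  have e1 : F.disp = 0 := by simpa using h4
  have e2 : F.vel = 0 := by
    refine (Lp.eq_zero_iff_ae_eq_zero).2 ?_
    filter_upwards [h5, hz] with x hx hx0
    simp only [hx, hw, map_zero, hx0, mul_zero, sub_zero, Pi.zero_apply]
  have e3 : F.temp = 0 := by
    refine (Lp.eq_zero_iff_ae_eq_zero).2 ?_
    filter_upwards [h6, hz] with x hx hx0
    simp only [hx, hq, map_zero, hx0, mul_zero, sub_zero, Pi.zero_apply]
  exact Prod.ext (Subtype.ext e1) (Prod.ext e2 e3)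

/-- The thermoelastic operator, as an unbounded operator in `H`. -/
def thermoOp {N : ℕ} (Ω : Opens (EuclideanSpace ℝ (Fin N))) (ε : ℝ)
    (a b : EuclideanSpace ℝ (Fin N) → Matrix (Fin N) (Fin N) ℝ)
    (c d γ : EuclideanSpace ℝ (Fin N) → ℝ) : EnergySpace Ω →ₗ.[ℂ] EnergySpace Ω :=
  (thermoGraph Ω ε a b c d γ).toLinearPMap

/-! ### Contraction semigroups and their generators -/

/-- `T` is a `C₀`-semigroup of contractions on the normed space `X`. -/
structure IsContractionSemigroup {X : Type*} [NormedAddCommGroup X] [NormedSpace ℂ X]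
    (T : ℝ≥0 → X →L[ℂ] X) : Prop where
  map_zero : T 0 = ContinuousLinearMap.id ℂ X
  map_add : ∀ s t, T (s + t) = (T s).comp (T t)
  strongCont : ∀ x, Tendsto (fun t => T t x) (𝓝[>] 0) (𝓝 x)
  contraction : ∀ t x, ‖T t x‖ ≤ ‖x‖

/-- `A` is the infinitesimal generator of `T`: `x ∈ D(A)` and `A x = y` iff
`(T(t)x - x)/t → y` as `t → 0⁺`. -/
def IsGenerator {X : Type*} [NormedAddCommGroup X] [NormedSpace ℂ X]
    (T : ℝ≥0 → X →L[ℂ] X) (A : X →ₗ.[ℂ] X) : Prop :=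
  ∀ x y, (x, y) ∈ A.graph ↔
    Tendsto (fun t : ℝ≥0 => ((t : ℝ) : ℂ)⁻¹ • (T t x - x)) (𝓝[>] 0) (𝓝 y)

/-- `A` generates a `C₀`-semigroup of contractions on `X`. -/
def GeneratesContractionSemigroup {X : Type*} [NormedAddCommGroup X] [NormedSpace ℂ X]
    (A : X →ₗ.[ℂ] X) : Prop :=
  ∃ T : ℝ≥0 → X →L[ℂ] X, IsContractionSemigroup T ∧ IsGenerator T A

end

/-!
The operator comes from a coercive form, and the proof is the form method followed by the
Lumer–Phillips theorem.

*The form domain.* `H¹₀(Ω)` is realized as the closed subspace `closedTestGraph Ω` of the Hilbert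
sum `L²(Ω) ⊕ L²(Ω)^N`, the closure of the pairs `(φ, ∇φ)`; the two projections are the embedding
`val` in `L²(Ω)`, which is injective because weak gradients are unique, and the gradient `nabla`.
The rescaled periodic coefficients act as bounded multiplication operators
(`exists_multiplication_operator`), the bounds on the cell being transported to almost every point
of `ℝ^N` by periodicity. Since `Ω` is bounded, the Poincaré inequality makes `∫ a_ε ∇u · conj ∇w`
coercive on `H¹₀(Ω)`. Testing with `H¹₀(Ω)` instead of test functions, `A_ε` is the operator of
this form (`closedTestGraph.mem_ellipticOp_graph_iff`).

*The square root.* Coercivity gives `A_ε⁻¹ = J J†` with `J` a bounded injection whose range is the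
form domain. The inverse of `(J J†)^{1/2}` is then a nonnegative self-adjoint square root. As the
domain of the root is that of an unspecified root, any root `S` has to be treated: its inverse `R`
is everywhere defined and symmetric, hence bounded by Hellinger–Toeplitz, and `R R† = J J†` forces
`range R = range J` by Douglas' lemma. So `D(A_ε^{1/2}) = H¹₀(Ω)` (`sqrtDomain_eq_range`).

*The generator.* By coercivity the energy form is equivalent to the product norm of
`H¹₀(Ω) × L²(Ω) × L²(Ω)`, hence complete. In `re ⟨U, 𝐀U⟩` the elastic terms and the coupling terms
cancel, and `-re ∫ b_ε ∇θ · conj ∇θ ≤ 0` is left (`re_energy_rate_nonpos`). For `l > 0` the equation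
`l U - 𝐀U = F` reduces, with `v = l u - f`, to two coercive equations on `H¹₀(Ω)` with skew
coupling, which are solved by two applications of Lax–Milgram (`exists_weak_resolvent`). The
Lumer–Phillips theorem concludes. It is proved through the Yosida approximation, and it needs no
separate density argument, as a dissipative operator with the range condition on a Hilbert space is
densely defined (`generatesContractionSemigroup_of_dissipative`).
-/

noncomputable section

/-! ### Exponentials of bounded operators and the Yosida approximation -/

section HilleYosida

variable {X : Type*} [NormedAddCommGroup X] [NormedSpace ℂ X]

theorem norm_exp_clm_le [CompleteSpace X] (B : X →L[ℂ] X) :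
    ‖NormedSpace.exp B‖ ≤ Real.exp ‖B‖ := by
  rw [NormedSpace.exp_eq_tsum ℝ, Real.exp_eq_exp_ℝ, NormedSpace.exp_eq_tsum ℝ]
  have hs : Summable fun n : ℕ => ((n.factorial : ℝ)⁻¹) • ‖B‖ ^ n :=
    NormedSpace.expSeries_summable' (𝕂 := ℝ) ‖B‖
  refine tsum_of_norm_bounded hs.hasSum fun n => ?_
  have hpow : ‖B ^ n‖ ≤ ‖B‖ ^ n := by
    rcases Nat.eq_zero_or_pos n with rfl | hn
    · rw [pow_zero, pow_zero]
      exact ContinuousLinearMap.norm_id_le (𝕜 := ℂ) (E := X)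
    · exact norm_pow_le' B hn
  rw [norm_smul, smul_eq_mul, norm_inv, Real.norm_natCast]
  gcongr

theorem exp_smul_zero_clm (B : X →L[ℂ] X) : NormedSpace.exp ((0 : ℝ) • B) = 1 := by
  rw [zero_smul, NormedSpace.exp_zero]

theorem exp_add_of_commute_clm [CompleteSpace X] {B C : X →L[ℂ] X} (h : Commute B C) :
    NormedSpace.exp (B + C) = NormedSpace.exp B * NormedSpace.exp C := by
  let _ : NormedAlgebra ℚ (X →L[ℂ] X) := NormedAlgebra.restrictScalars ℚ ℝ _
  exact NormedSpace.exp_add_of_commute h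

/-- If `‖R‖ ≤ 1/l`, then `exp (t (l² R - l))` is a contraction for `t ≥ 0`. -/
theorem norm_exp_yosida_le [CompleteSpace X] {R : X →L[ℂ] X} {l t : ℝ} (hl : 0 < l)
    (ht : 0 ≤ t) (hR : ‖R‖ ≤ l⁻¹) :
    ‖NormedSpace.exp (t • (l ^ 2 • R - l • (1 : X →L[ℂ] X)))‖ ≤ 1 := by
  have hsplit : t • (l ^ 2 • R - l • (1 : X →L[ℂ] X)) =
      (t * l ^ 2) • R + (-(t * l)) • (1 : X →L[ℂ] X) := by
    rw [smul_sub, smul_smul, smul_smul, neg_smul, sub_eq_add_neg]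
  have hone : NormedSpace.exp ((-(t * l)) • (1 : X →L[ℂ] X)) =
      Real.exp (-(t * l)) • (1 : X →L[ℂ] X) := by
    have h := NormedSpace.algebraMap_exp_comm (𝕂 := ℝ) (𝔸 := X →L[ℂ] X) (-(t * l))
    rw [Algebra.algebraMap_eq_smul_one, Algebra.algebraMap_eq_smul_one] at h
    rw [← h, Real.exp_eq_exp_ℝ]
  rw [hsplit, exp_add_of_commute_clm ((Commute.one_right _).smul_right _), hone, mul_smul_comm,
    mul_one, norm_smul, Real.norm_eq_abs, abs_of_pos (Real.exp_pos _)]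
  have h1 : ‖(t * l ^ 2) • R‖ ≤ t * l := by
    rw [norm_smul, Real.norm_of_nonneg (by positivity)]
    calc t * l ^ 2 * ‖R‖ ≤ t * l ^ 2 * l⁻¹ := by gcongr
      _ = t * l := by field_simp
  calc Real.exp (-(t * l)) * ‖NormedSpace.exp ((t * l ^ 2) • R)‖
      ≤ Real.exp (-(t * l)) * Real.exp (t * l) := by
        gcongr
        exact (norm_exp_clm_le _).trans (Real.exp_le_exp.2 h1)
    _ = 1 := by rw [← Real.exp_add, neg_add_cancel, Real.exp_zero]

theorem hasDerivAt_exp_smul_apply [CompleteSpace X] (B : X →L[ℂ] X) (x : X) (t : ℝ) :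
    HasDerivAt (fun s : ℝ => NormedSpace.exp (s • B) x) (NormedSpace.exp (t • B) (B x)) t := by
  have h := hasDerivAt_exp_smul_const (𝕂 := ℝ) B t
  exact ((ContinuousLinearMap.apply ℂ X x).restrictScalars ℝ).hasFDerivAt.comp_hasDerivAt t h

/-- Two commuting bounded generators of contractive groups for positive times: the difference of
their exponentials is controlled by the difference of the generators. -/
theorem norm_exp_sub_exp_le [CompleteSpace X] {B C : X →L[ℂ] X} (hBC : Commute B C)
    (hB : ∀ t : ℝ, 0 ≤ t → ‖NormedSpace.exp (t • B)‖ ≤ 1)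
    (hC : ∀ t : ℝ, 0 ≤ t → ‖NormedSpace.exp (t • C)‖ ≤ 1) {t : ℝ} (ht : 0 ≤ t) (x : X) :
    ‖NormedSpace.exp (t • B) x - NormedSpace.exp (t • C) x‖ ≤ t * ‖B x - C x‖ := by
  -- interpolate along `s ↦ exp (s B) exp ((t - s) C) x`, whose derivative is
  -- `exp (s B) exp ((t - s) C) (B - C) x`
  have hcomm : ∀ s : ℝ, Commute B (NormedSpace.exp (s • C)) := fun s =>
    (hBC.smul_right s).exp_right
  have hder : ∀ s : ℝ, HasDerivAt
      (fun r : ℝ => (NormedSpace.exp (r • B) * NormedSpace.exp ((t - r) • C)) x)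
      ((NormedSpace.exp (s • B) * NormedSpace.exp ((t - s) • C)) (B x - C x)) s := by
    intro s
    have h1 := hasDerivAt_exp_smul_const (𝕂 := ℝ) B s
    have h2 : HasDerivAt (fun r : ℝ => NormedSpace.exp ((t - r) • C))
        (-(NormedSpace.exp ((t - s) • C) * C)) s := by
      have h := (hasDerivAt_exp_smul_const (𝕂 := ℝ) C (t - s)).scomp s
        ((hasDerivAt_id s).const_sub t)
      rw [neg_one_smul] at h
      exact h
    have h3 := h1.mul h2
    have h4 : HasDerivAt
        (fun r : ℝ => (NormedSpace.exp (r • B) * NormedSpace.exp ((t - r) • C)) x)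
        ((NormedSpace.exp (s • B) * B * NormedSpace.exp ((t - s) • C) +
          NormedSpace.exp (s • B) * -(NormedSpace.exp ((t - s) • C) * C)) x) s :=
      ((ContinuousLinearMap.apply ℂ X x).restrictScalars ℝ).hasFDerivAt.comp_hasDerivAt s h3
    convert h4 using 1
    have e : NormedSpace.exp (s • B) * B * NormedSpace.exp ((t - s) • C) =
        NormedSpace.exp (s • B) * NormedSpace.exp ((t - s) • C) * B := by
      rw [mul_assoc, (hcomm _).eq, mul_assoc]
    rw [e]
    simp [sub_eq_add_neg]
  have hb : ∀ s ∈ Set.Ico (0 : ℝ) t,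
      ‖(NormedSpace.exp (s • B) * NormedSpace.exp ((t - s) • C)) (B x - C x)‖ ≤ ‖B x - C x‖ := by
    intro s hs
    refine (ContinuousLinearMap.le_of_opNorm_le _ (c := 1) ?_ _).trans_eq (one_mul _)
    refine (norm_mul_le _ _).trans ?_
    exact mul_le_one₀ (hB s hs.1) (norm_nonneg _) (hC (t - s) (by linarith [hs.2]))
  have h := norm_image_sub_le_of_norm_deriv_le_segment'
    (fun s _ => (hder s).hasDerivWithinAt) hb t (Set.right_mem_Icc.2 ht)
  simpa [exp_smul_zero_clm, mul_comm] using h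

/-- First-order Taylor estimate for a contractive exponential. -/
theorem norm_exp_sub_sub_le [CompleteSpace X] {B : X →L[ℂ] X}
    (hB : ∀ t : ℝ, 0 ≤ t → ‖NormedSpace.exp (t • B)‖ ≤ 1) {t : ℝ} (ht : 0 ≤ t) (x z w : X) :
    ‖NormedSpace.exp (t • B) x - x - t • z‖ ≤
      t * (‖B x - z‖ + 2 * ‖z - w‖ + t * ‖B w‖) := by
  have hle : ∀ s : ℝ, 0 ≤ s → ∀ y : X, ‖NormedSpace.exp (s • B) y‖ ≤ ‖y‖ := fun s hs y =>
    (ContinuousLinearMap.le_of_opNorm_le _ (hB s hs) y).trans_eq (one_mul _)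
  have hw : ∀ s : ℝ, 0 ≤ s → ‖NormedSpace.exp (s • B) w - w‖ ≤ s * ‖B w‖ := by
    intro s hs
    have h := norm_image_sub_le_of_norm_deriv_le_segment' (C := ‖B w‖)
      (fun r _ => (hasDerivAt_exp_smul_apply B w r).hasDerivWithinAt)
      (fun r hr => hle r hr.1 _) s (Set.right_mem_Icc.2 hs)
    simpa [exp_smul_zero_clm, mul_comm] using h
  have hder : ∀ s : ℝ, HasDerivAt (fun r : ℝ => NormedSpace.exp (r • B) x - r • z)
      (NormedSpace.exp (s • B) (B x) - z) s := fun s => by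
    have h := (hasDerivAt_exp_smul_apply B x s).sub ((hasDerivAt_id s).smul_const z)
    rw [one_smul] at h
    exact h
  have hb : ∀ s ∈ Set.Ico (0 : ℝ) t, ‖NormedSpace.exp (s • B) (B x) - z‖ ≤
      ‖B x - z‖ + 2 * ‖z - w‖ + t * ‖B w‖ := by
    intro s hs
    have e : NormedSpace.exp (s • B) (B x) - z = NormedSpace.exp (s • B) (B x - z) +
        (NormedSpace.exp (s • B) (z - w) + ((NormedSpace.exp (s • B) w - w) - (z - w))) := by
      simp only [map_sub]; abel
    rw [e]
    have h1 := hle s hs.1 (B x - z)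
    have h2 := hle s hs.1 (z - w)
    have h3 := hw s hs.1
    have h4 : s * ‖B w‖ ≤ t * ‖B w‖ := by have := hs.2.le; gcongr
    have n1 := norm_add_le (NormedSpace.exp (s • B) (B x - z))
      (NormedSpace.exp (s • B) (z - w) + ((NormedSpace.exp (s • B) w - w) - (z - w)))
    have n2 := norm_add_le (NormedSpace.exp (s • B) (z - w))
      ((NormedSpace.exp (s • B) w - w) - (z - w))
    have n3 := norm_sub_le (NormedSpace.exp (s • B) w - w) (z - w)
    linarith
  have h := norm_image_sub_le_of_norm_deriv_le_segment'
    (fun s _ => (hder s).hasDerivWithinAt) hb t (Set.right_mem_Icc.2 ht)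
  rw [mul_comm t]
  simpa [exp_smul_zero_clm, sub_right_comm] using h

/-- A sequence of contractions that converges pointwise on a dense set converges pointwise. -/
theorem exists_tendsto_of_dense [CompleteSpace X] {T : ℕ → X →L[ℂ] X} (hT : ∀ n, ‖T n‖ ≤ 1)
    {D : Set X} (hD : Dense D) (h : ∀ x ∈ D, CauchySeq fun n => T n x) (x : X) :
    ∃ y, Tendsto (fun n => T n x) atTop (𝓝 y) := by
  refine cauchySeq_tendsto_of_complete (Metric.cauchySeq_iff'.2 fun e he => ?_)
  obtain ⟨w, hw, hxw⟩ := Metric.dense_iff.1 hD x (e / 3) (by positivity)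
  rw [Metric.mem_ball, dist_comm, dist_eq_norm] at hw
  obtain ⟨M, hM⟩ := Metric.cauchySeq_iff'.1 (h w hxw) (e / 3) (by positivity)
  refine ⟨M, fun n hn => ?_⟩
  have hle : ∀ k, ‖T k (x - w)‖ ≤ ‖x - w‖ := fun k =>
    (ContinuousLinearMap.le_of_opNorm_le _ (hT k) _).trans_eq (one_mul _)
  have h1 := hM n hn
  rw [dist_eq_norm] at h1 ⊢
  have e1 : T n x - T M x = (T n (x - w) - T M (x - w)) + (T n w - T M w) := by
    simp only [map_sub]; abel
  rw [e1]
  have n1 := norm_add_le (T n (x - w) - T M (x - w)) (T n w - T M w)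
  have n2 := norm_sub_le (T n (x - w)) (T M (x - w))
  linarith [hle n, hle M]

/-- The data of the Yosida approximation of a densely defined operator `A`: commuting bounded
operators `Y n` that generate contractions and converge to `A` pointwise on the domain of `A`. -/
structure IsYosidaApprox (A : X →ₗ.[ℂ] X) (Y : ℕ → X →L[ℂ] X) : Prop where
  contr : ∀ n, ∀ t : ℝ, 0 ≤ t → ‖NormedSpace.exp (t • Y n)‖ ≤ 1
  comm : ∀ n m, Commute (Y n) (Y m)
  tendsto : ∀ x y, (x, y) ∈ A.graph → Tendsto (fun n => Y n x) atTop (𝓝 y)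

/-- A dissipative operator with the range condition has bounded resolvents `R = (l - A)⁻¹`, of norm
at most `1/l`. -/
theorem exists_resolvent {A : X →ₗ.[ℂ] X}
    (hdiss : ∀ l : ℝ, 0 < l → ∀ x y, (x, y) ∈ A.graph → l * ‖x‖ ≤ ‖l • x - y‖)
    (hsurj : ∀ l : ℝ, 0 < l → ∀ z, ∃ x y, (x, y) ∈ A.graph ∧ l • x - y = z)
    {l : ℝ} (hl : 0 < l) :
    ∃ R : X →L[ℂ] X, ‖R‖ ≤ l⁻¹ ∧ (∀ z, (R z, l • R z - z) ∈ A.graph) ∧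
      ∀ x y, (x, y) ∈ A.graph → R (l • x - y) = x := by
  choose f g hfg hz using hsurj l hl
  have huniq : ∀ x y, (x, y) ∈ A.graph → f (l • x - y) = x := by
    intro x y hxy
    have h1 := hdiss l hl _ _ (Submodule.sub_mem _ (hfg (l • x - y)) hxy)
    have h2 : l • (f (l • x - y) - x) - (g (l • x - y) - y) = 0 := by
      have := hz (l • x - y)
      rw [smul_sub, sub_sub_sub_comm, this, sub_self]
    rw [h2, norm_zero] at h1
    have h3 : ‖f (l • x - y) - x‖ ≤ 0 := by
      by_contra hc
      push Not at hc
      have := mul_pos hl hc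
      linarith
    exact sub_eq_zero.1 (norm_le_zero_iff.1 h3)
  have hg : ∀ z, g z = l • f z - z := fun z => by
    rw [eq_sub_iff_add_eq, add_comm, ← eq_sub_iff_add_eq]
    exact (hz z).symm
  have hbound : ∀ z, ‖f z‖ ≤ l⁻¹ * ‖z‖ := fun z => by
    have h1 := hdiss l hl _ _ (hfg z)
    rw [hz z] at h1
    rw [inv_mul_eq_div, le_div_iff₀ hl, mul_comm]
    exact h1
  let R : X →ₗ[ℂ] X :=
    { toFun := f
      map_add' := fun z w => by
        have h := huniq _ _ (Submodule.add_mem _ (hfg z) (hfg w))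
        simp only [smul_add, add_sub_add_comm, hz] at h
        exact h
      map_smul' := fun k z => by
        have h := huniq _ _ (Submodule.smul_mem _ k (hfg z))
        simp only [smul_comm l k, ← smul_sub, hz] at h
        exact h }
  refine ⟨R.mkContinuous l⁻¹ hbound, R.mkContinuous_norm_le (by positivity) _, fun z => ?_,
    huniq⟩
  change (f z, l • f z - z) ∈ A.graph
  rw [← hg]
  exact hfg z

/-- The Yosida approximation `l² (l - A)⁻¹ - l`, along `l = n + 1`. The resolvent identity makes its
members commute. -/
theorem exists_yosidaApprox {A : X →ₗ.[ℂ] X} [CompleteSpace X]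
    (hdiss : ∀ l : ℝ, 0 < l → ∀ x y, (x, y) ∈ A.graph → l * ‖x‖ ≤ ‖l • x - y‖)
    (hsurj : ∀ l : ℝ, 0 < l → ∀ z, ∃ x y, (x, y) ∈ A.graph ∧ l • x - y = z)
    (hdense : Dense (A.domain : Set X)) : ∃ Y, IsYosidaApprox A Y := by
  have hpos : ∀ n : ℕ, (0 : ℝ) < n + 1 := fun n => by positivity
  choose R hRn hRg hRu using fun n : ℕ => exists_resolvent hdiss hsurj (hpos n)
  have hres : ∀ n m, R n = R m + (((m : ℝ) + 1) - ((n : ℝ) + 1)) • (R n * R m) := by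
    intro n m
    ext y
    have h := hRu n _ _ (hRg m y)
    have e : ((n : ℝ) + 1) • R m y - (((m : ℝ) + 1) • R m y - y) =
        y - (((m : ℝ) + 1) - ((n : ℝ) + 1)) • R m y := by
      rw [sub_smul]; abel
    rw [e, map_sub, sub_eq_iff_eq_add] at h
    rw [h]
    simp [(R n).map_smul_of_tower]
  have hcomm : ∀ n m, Commute (R n) (R m) := by
    intro n m
    rcases eq_or_ne n m with rfl | hne
    · exact Commute.refl _
    · have h1 := hres n m
      have h2 := hres m n
      have hk : ((m : ℝ) + 1) - ((n : ℝ) + 1) ≠ 0 := by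
        intro h
        exact hne (by exact_mod_cast (by linarith : (n : ℝ) = m))
      have h3 : (((m : ℝ) + 1) - ((n : ℝ) + 1)) • (R n * R m) =
          (((m : ℝ) + 1) - ((n : ℝ) + 1)) • (R m * R n) := by
        rw [← sub_eq_iff_eq_add'] at h1 h2
        rw [← h1, ← neg_sub ((n : ℝ) + 1) ((m : ℝ) + 1), neg_smul, ← h2, neg_sub]
      exact smul_right_injective _ hk h3
  have hid : ∀ x, Tendsto (fun n : ℕ => ((n : ℝ) + 1) • R n x) atTop (𝓝 x) := by
    have hlim : Tendsto (fun n : ℕ => ((n : ℝ) + 1)⁻¹) atTop (𝓝 0) :=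
      tendsto_inv_atTop_zero.comp
        (tendsto_atTop_add_const_right _ _ tendsto_natCast_atTop_atTop)
    have hdom : ∀ x y, (x, y) ∈ A.graph →
        Tendsto (fun n : ℕ => ((n : ℝ) + 1) • R n x) atTop (𝓝 x) := by
      intro x y hxy
      rw [tendsto_iff_norm_sub_tendsto_zero]
      refine squeeze_zero (fun _ => norm_nonneg _) (fun n => ?_)
        (by simpa using hlim.mul_const ‖y‖)
      have h := hRu n _ _ hxy
      rw [map_sub, (R n).map_smul_of_tower, sub_eq_iff_eq_add] at h
      rw [h, add_sub_cancel_left]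
      exact ContinuousLinearMap.le_of_opNorm_le _ (hRn n) y
    intro x
    rw [Metric.tendsto_atTop]
    intro e he
    obtain ⟨w, hw, hxw⟩ := Metric.dense_iff.1 hdense x (e / 3) (by positivity)
    rw [Metric.mem_ball, dist_comm, dist_eq_norm] at hw
    obtain ⟨M, hM⟩ := Metric.tendsto_atTop.1
      (hdom w _ (LinearPMap.mem_graph A ⟨w, hxw⟩)) (e / 3) (by positivity)
    refine ⟨M, fun n hn => ?_⟩
    have h1 := hM n hn
    rw [dist_eq_norm] at h1 ⊢
    have h2 : ‖((n : ℝ) + 1) • R n (x - w)‖ ≤ ‖x - w‖ := by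
      rw [norm_smul, Real.norm_of_nonneg (hpos n).le]
      calc ((n : ℝ) + 1) * ‖R n (x - w)‖ ≤ ((n : ℝ) + 1) * (((n : ℝ) + 1)⁻¹ * ‖x - w‖) := by
            gcongr
            exact ContinuousLinearMap.le_of_opNorm_le _ (hRn n) _
        _ = ‖x - w‖ := by field_simp
    have e1 : ((n : ℝ) + 1) • R n x - x =
        ((n : ℝ) + 1) • R n (x - w) + (((n : ℝ) + 1) • R n w - w) - (x - w) := by
      simp only [map_sub, smul_sub]; abel
    rw [e1]
    have n1 := norm_sub_le (((n : ℝ) + 1) • R n (x - w) + (((n : ℝ) + 1) • R n w - w)) (x - w)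
    have n2 := norm_add_le (((n : ℝ) + 1) • R n (x - w)) (((n : ℝ) + 1) • R n w - w)
    linarith
  refine ⟨fun n => ((n : ℝ) + 1) ^ 2 • R n - ((n : ℝ) + 1) • 1,
    fun n t ht => norm_exp_yosida_le (hpos n) ht (hRn n), fun n m => ?_, fun x y hxy => ?_⟩
  · have h := ((hcomm n m).smul_left (((n : ℝ) + 1) ^ 2)).smul_right (((m : ℝ) + 1) ^ 2)
    have h1 : ∀ (C : X →L[ℂ] X) (k : ℝ), Commute C (k • (1 : X →L[ℂ] X)) := fun C k =>
      (Commute.one_right C).smul_right k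
    exact (h.sub_right (h1 _ _)).sub_left
      (((h1 _ _).symm).sub_right (h1 _ _))
  · refine (hid y).congr fun n => ?_
    have h := hRu n _ _ hxy
    rw [map_sub, (R n).map_smul_of_tower] at h
    have h2 : ((n : ℝ) + 1) • (((n : ℝ) + 1) • R n x) - ((n : ℝ) + 1) • R n y =
        ((n : ℝ) + 1) • x := by
      rw [← smul_sub, h]
    change _ = ((n : ℝ) + 1) ^ 2 • R n x - ((n : ℝ) + 1) • x
    rw [← h2, pow_two, mul_smul]
    abel

end HilleYosida

/-! ### The generation theorem for contraction semigroups -/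

section Generation

variable {X : Type*} [NormedAddCommGroup X]

section Banach

variable [NormedSpace ℂ X]

/-- The exponentials of a Yosida approximation converge to a semigroup of contractions `T`, and
`T` satisfies a first-order Taylor estimate on the domain of `A`. -/
theorem IsYosidaApprox.exists_limit [CompleteSpace X] {A : X →ₗ.[ℂ] X} {Y : ℕ → X →L[ℂ] X}
    (hY : IsYosidaApprox A Y) (hdense : Dense (A.domain : Set X)) :
    ∃ T : ℝ≥0 → X →L[ℂ] X, T 0 = ContinuousLinearMap.id ℂ X ∧
      (∀ s t, T (s + t) = (T s).comp (T t)) ∧ (∀ t x, ‖T t x‖ ≤ ‖x‖) ∧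
      ∀ x y w z, (x, y) ∈ A.graph → (w, z) ∈ A.graph → ∀ t : ℝ≥0,
        ‖T t x - x - (t : ℝ) • y‖ ≤ t * (2 * ‖y - w‖ + t * ‖z‖) := by
  have hlim : ∀ (t : ℝ≥0) (x : X),
      ∃ y, Tendsto (fun n => NormedSpace.exp ((t : ℝ) • Y n) x) atTop (𝓝 y) := by
    intro t
    refine exists_tendsto_of_dense (fun n => hY.contr n t t.2) hdense fun x hx => ?_
    have hc := (hY.tendsto x _ (LinearPMap.mem_graph A ⟨x, hx⟩)).cauchySeq
    rw [Metric.cauchySeq_iff] at hc ⊢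
    intro e he
    obtain ⟨M, hM⟩ := hc (e / (t + 1)) (by positivity)
    refine ⟨M, fun m hm n hn => ?_⟩
    have h1 := hM m hm n hn
    rw [dist_eq_norm] at h1 ⊢
    have h2 := norm_exp_sub_exp_le (hY.comm m n) (hY.contr m) (hY.contr n) t.2 x
    rw [lt_div_iff₀ (by positivity)] at h1
    have h3 := norm_nonneg (Y m x - Y n x)
    have h4 : (t : ℝ) * ‖Y m x - Y n x‖ ≤ ‖Y m x - Y n x‖ * (t + 1) := by nlinarith
    exact (h2.trans h4).trans_lt h1
  choose T hT using hlim
  have hTle : ∀ t x, ‖T t x‖ ≤ ‖x‖ := fun t x =>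
    le_of_tendsto (hT t x).norm (Eventually.of_forall fun n =>
      (ContinuousLinearMap.le_of_opNorm_le _ (hY.contr n t t.2) x).trans_eq (one_mul _))
  let L : ℝ≥0 → X →L[ℂ] X := fun t => LinearMap.mkContinuous
    { toFun := T t
      map_add' := fun x y => tendsto_nhds_unique (hT t (x + y)) (by
        simpa only [map_add] using (hT t x).add (hT t y))
      map_smul' := fun k x => tendsto_nhds_unique (hT t (k • x)) (by
        simpa only [map_smul, RingHom.id_apply] using (hT t x).const_smul k) } 1
    fun x => (hTle t x).trans_eq (one_mul _).symm
  refine ⟨L, ?_, fun s t => ?_, hTle, fun x y w z hxy hwz t => ?_⟩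
  · ext x
    refine tendsto_nhds_unique (hT 0 x) ?_
    simp
  · ext x
    refine tendsto_nhds_unique (hT (s + t) x) ?_
    have e : ∀ n, NormedSpace.exp (((s + t : ℝ≥0) : ℝ) • Y n) x =
        NormedSpace.exp ((s : ℝ) • Y n) (NormedSpace.exp ((t : ℝ) • Y n) x - T t x) +
          NormedSpace.exp ((s : ℝ) • Y n) (T t x) := by
      intro n
      rw [NNReal.coe_add, add_smul, exp_add_of_commute_clm
        (((Commute.refl (Y n)).smul_left _).smul_right _), map_sub, sub_add_cancel]
      rfl
    have h1 : Tendsto (fun n =>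
        NormedSpace.exp ((s : ℝ) • Y n) (NormedSpace.exp ((t : ℝ) • Y n) x - T t x))
        atTop (𝓝 0) :=
      squeeze_zero_norm (fun n => (ContinuousLinearMap.le_of_opNorm_le _
        (hY.contr n s s.2) _).trans_eq (one_mul _))
        (tendsto_iff_norm_sub_tendsto_zero.1 (hT t x))
    have h2 := h1.add (hT s (T t x))
    rw [zero_add] at h2
    exact h2.congr fun n => (e n).symm
  · have h1 := ((hT t x).sub_const x).sub_const ((t : ℝ) • y)
    have h2 : Tendsto (fun n => (t : ℝ) * (‖Y n x - y‖ + 2 * ‖y - w‖ + t * ‖Y n w‖)) atTop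
        (𝓝 (t * (0 + 2 * ‖y - w‖ + t * ‖z‖))) :=
      (((tendsto_iff_norm_sub_tendsto_zero.1 (hY.tendsto x y hxy)).add_const _).add
        ((hY.tendsto w z hwz).norm.const_mul _)).const_mul _
    rw [zero_add] at h2
    exact le_of_tendsto_of_tendsto' h1.norm h2 fun n =>
      norm_exp_sub_sub_le (hY.contr n) t.2 x y w

theorem tendsto_coe_nhdsGT_zero : Tendsto (fun t : ℝ≥0 => (t : ℝ)) (𝓝[>] 0) (𝓝 0) :=
  (NNReal.continuous_coe.tendsto' 0 0 rfl).mono_left nhdsWithin_le_nhds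

/-- The **Hille–Yosida theorem** for contraction semigroups. -/
theorem generatesContractionSemigroup_of_resolvent [CompleteSpace X] {A : X →ₗ.[ℂ] X}
    (hdiss : ∀ l : ℝ, 0 < l → ∀ x y, (x, y) ∈ A.graph → l * ‖x‖ ≤ ‖l • x - y‖)
    (hsurj : ∀ l : ℝ, 0 < l → ∀ z, ∃ x y, (x, y) ∈ A.graph ∧ l • x - y = z)
    (hdense : Dense (A.domain : Set X)) : GeneratesContractionSemigroup A := by
  obtain ⟨Y, hY⟩ := exists_yosidaApprox hdiss hsurj hdense
  obtain ⟨T, hT0, hTadd, hTle, hTaylor⟩ := hY.exists_limit hdense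
  have hgen : ∀ x y, (x, y) ∈ A.graph →
      Tendsto (fun t : ℝ≥0 => ((t : ℝ) : ℂ)⁻¹ • (T t x - x)) (𝓝[>] 0) (𝓝 y) := by
    intro x y hxy
    rw [Metric.tendsto_nhds]
    intro e he
    obtain ⟨w, hw, hxw⟩ := Metric.dense_iff.1 hdense y (e / 4) (by positivity)
    rw [Metric.mem_ball, dist_comm, dist_eq_norm] at hw
    have hwz := LinearPMap.mem_graph A ⟨w, hxw⟩
    have hsmall : ∀ᶠ t : ℝ≥0 in 𝓝[>] 0, (t : ℝ) * ‖A ⟨w, hxw⟩‖ < e / 2 := by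
      have h := tendsto_coe_nhdsGT_zero.mul_const ‖A ⟨w, hxw⟩‖
      rw [zero_mul] at h
      exact h.eventually_lt_const (by positivity)
    filter_upwards [hsmall, self_mem_nhdsWithin] with t ht ht0
    have ht0' : (0 : ℝ) < t := ht0
    have h := hTaylor x y w _ hxy hwz t
    have e1 : ((t : ℝ) : ℂ)⁻¹ • (T t x - x) - y =
        ((t : ℝ) : ℂ)⁻¹ • (T t x - x - (t : ℝ) • y) := by
      have hne : ((t : ℝ) : ℂ) ≠ 0 := by exact_mod_cast ht0'.ne'
      rw [← Complex.coe_smul, smul_sub _ _ (((t : ℝ) : ℂ) • y), smul_smul, inv_mul_cancel₀ hne,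
        one_smul]
    rw [dist_eq_norm, e1, norm_smul, norm_inv, Complex.norm_real, Real.norm_of_nonneg ht0'.le,
      inv_mul_lt_iff₀ ht0']
    refine h.trans_lt (mul_lt_mul_of_pos_left ?_ ht0')
    change 2 * ‖y - w‖ + (t : ℝ) * ‖A ⟨w, hxw⟩‖ < e
    linarith
  have hcont : ∀ x, Tendsto (fun t => T t x) (𝓝[>] 0) (𝓝 x) := by
    intro x
    rw [Metric.tendsto_nhds]
    intro e he
    obtain ⟨w, hw, hxw⟩ := Metric.dense_iff.1 hdense x (e / 4) (by positivity)
    rw [Metric.mem_ball, dist_comm, dist_eq_norm] at hw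
    have hwT : Tendsto (fun t : ℝ≥0 => T t w) (𝓝[>] 0) (𝓝 w) := by
      have hc : Tendsto (fun t : ℝ≥0 => ((t : ℝ) : ℂ)) (𝓝[>] 0) (𝓝 0) := by
        have h := (Complex.continuous_ofReal.tendsto 0).comp tendsto_coe_nhdsGT_zero
        rwa [Complex.ofReal_zero] at h
      have h := (hc.smul (hgen w _ (LinearPMap.mem_graph A ⟨w, hxw⟩))).add_const w
      rw [zero_smul, zero_add] at h
      refine h.congr' ?_
      filter_upwards [self_mem_nhdsWithin] with t ht0
      have ht0' : (0 : ℝ) < t := ht0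
      have hne : ((t : ℝ) : ℂ) ≠ 0 := by exact_mod_cast ht0'.ne'
      rw [smul_smul, mul_inv_cancel₀ hne, one_smul, sub_add_cancel]
    filter_upwards [Metric.tendsto_nhds.1 hwT (e / 2) (by positivity)] with t ht
    rw [dist_eq_norm] at ht ⊢
    have e1 : T t x - x = T t (x - w) + (T t w - w) - (x - w) := by
      simp only [map_sub]; abel
    rw [e1]
    have n1 := norm_sub_le (T t (x - w) + (T t w - w)) (x - w)
    have n2 := norm_add_le (T t (x - w)) (T t w - w)
    have n3 := hTle t (x - w)
    linarith
  refine ⟨T, ⟨hT0, hTadd, hcont, hTle⟩, fun x y => ⟨hgen x y, fun hxy => ?_⟩⟩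
  -- The generator extends `A`, and `1 - A` is already onto, so it is enough that `1` is not an
  -- eigenvalue of the generator.
  obtain ⟨u, v, huv, huv'⟩ := hsurj 1 one_pos (x - y)
  rw [one_smul] at huv'
  set w := x - u with hw
  have hwlim : Tendsto (fun t : ℝ≥0 => ((t : ℝ) : ℂ)⁻¹ • (T t w - w)) (𝓝[>] 0) (𝓝 w) := by
    have h := hxy.sub (hgen u v huv)
    have e : y - v = w := by
      rw [sub_eq_sub_iff_add_eq_add] at huv'
      rw [hw, sub_eq_sub_iff_add_eq_add, add_comm y, huv']
    rw [e] at h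
    refine h.congr fun t => ?_
    rw [hw, ← smul_sub, map_sub]
    congr 1
    abel
  have hw0 : ‖w‖ ≤ 0 := by
    have h := (hwlim.const_sub w).norm
    rw [sub_self, norm_zero] at h
    refine ge_of_tendsto h ?_
    filter_upwards [self_mem_nhdsWithin] with t ht0
    have ht0' : (0 : ℝ) < t := ht0
    have hne : ((t : ℝ) : ℂ) ≠ 0 := by exact_mod_cast ht0'.ne'
    have e1 : ((t : ℝ) : ℂ) • (w - ((t : ℝ) : ℂ)⁻¹ • (T t w - w)) =
        (1 + (t : ℝ)) • w - T t w := by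
      rw [smul_sub, smul_smul, mul_inv_cancel₀ hne, one_smul, Complex.coe_smul, add_smul, one_smul]
      abel
    have n1 := norm_sub_norm_le ((1 + (t : ℝ)) • w) (T t w)
    rw [← e1, norm_smul, norm_smul, Complex.norm_real, Real.norm_of_nonneg ht0'.le,
      Real.norm_of_nonneg (by positivity)] at n1
    have n2 := hTle t w
    refine le_of_mul_le_mul_left ?_ ht0'
    linarith
  have hxu : x = u := sub_eq_zero.1 (norm_le_zero_iff.1 hw0)
  have hyv : y = v := by
    rw [hxu] at huv'
    exact (sub_right_injective huv').symm
  rw [hxu, hyv]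
  exact huv

end Banach

/-- The **Lumer–Phillips theorem** in a Hilbert space, with the range condition for all `l > 0`.
The density of the domain is automatic. -/
theorem generatesContractionSemigroup_of_dissipative [InnerProductSpace ℂ X] [CompleteSpace X]
    {A : X →ₗ.[ℂ] X} (hdiss : ∀ x y, (x, y) ∈ A.graph → (⟪x, y⟫_ℂ).re ≤ 0)
    (hsurj : ∀ l : ℝ, 0 < l → ∀ z, ∃ x y, (x, y) ∈ A.graph ∧ l • x - y = z) :
    GeneratesContractionSemigroup A := by
  refine generatesContractionSemigroup_of_resolvent (fun l hl x y hxy => ?_) hsurj ?_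
  · have h1 : l * ‖x‖ ^ 2 ≤ (⟪x, l • x - y⟫_ℂ).re := by
      have h := hdiss x y hxy
      have e : (⟪x, l • x⟫_ℂ).re = l * ‖x‖ ^ 2 := by
        rw [← Complex.coe_smul, inner_smul_right, Complex.re_ofReal_mul, ← inner_self_eq_norm_sq
          (𝕜 := ℂ)]
        rfl
      rw [inner_sub_right, Complex.sub_re, e]
      linarith
    have h2 := (Complex.re_le_norm _).trans (norm_inner_le_norm (𝕜 := ℂ) x (l • x - y))
    rcases (norm_nonneg x).eq_or_lt with h0 | h0
    · rw [← h0, mul_zero]; exact norm_nonneg _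
    · exact le_of_mul_le_mul_left (by nlinarith) h0
  · refine (Submodule.dense_iff_topologicalClosure_eq_top).2 ?_
    rw [Submodule.topologicalClosure_eq_top_iff, Submodule.eq_bot_iff]
    intro z hz
    obtain ⟨x, y, hxy, hxyz⟩ := hsurj 1 one_pos z
    rw [one_smul] at hxyz
    have h0 : ⟪x, z⟫_ℂ = 0 :=
      hz x (LinearPMap.mem_domain_of_mem_graph hxy)
    rw [← hxyz, inner_sub_right, sub_eq_zero] at h0
    have h1 := hdiss x y hxy
    rw [← h0] at h1
    have hx : x = 0 := by
      have h2 : ‖x‖ ^ 2 ≤ 0 := by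
        rw [← inner_self_eq_norm_sq (𝕜 := ℂ)]; exact h1
      exact norm_eq_zero.1 (by nlinarith [norm_nonneg x])
    subst hx
    have hy : y = 0 := LinearPMap.graph_fst_eq_zero_snd A hxy rfl
    rw [← hxyz, hy, sub_zero]

end Generation

/-! ### Operators defined by coercive forms, and their square roots -/

section Form

variable {X V W : Type*} [NormedAddCommGroup X] [InnerProductSpace ℂ X] [CompleteSpace X]
  [NormedAddCommGroup V] [InnerProductSpace ℂ V] [CompleteSpace V]
  [NormedAddCommGroup W] [InnerProductSpace ℂ W] [CompleteSpace W]

open ContinuousLinearMap (adjoint)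

/-- The **Lax–Milgram lemma** for a complex Hilbert space. -/
theorem isUnit_of_coercive {T : V →L[ℂ] V} {k : ℝ} (hk : 0 < k)
    (hT : ∀ v, k * ‖v‖ ^ 2 ≤ (⟪T v, v⟫_ℂ).re) : IsUnit T :=
  ContinuousLinearMap.isUnit_of_forall_le_norm_inner_map T (c := ⟨k, hk.le⟩) hk fun v => by
    rw [mul_comm]
    exact (hT v).trans (Complex.re_le_norm _)

theorem denseRange_adjoint_of_injective {J : V →L[ℂ] X} (hJ : Function.Injective J) :
    DenseRange (adjoint J) := by
  have h : (adjoint J).range.topologicalClosure = ⊤ := by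
    rw [Submodule.topologicalClosure_eq_top_iff, ContinuousLinearMap.orthogonal_range,
      ContinuousLinearMap.adjoint_adjoint]
    exact LinearMap.ker_eq_bot.2 hJ
  exact (Submodule.dense_iff_topologicalClosure_eq_top).2 h

/-- One half of **Douglas' lemma**: the range of `J` is determined by `J J†`. -/
theorem range_le_range_of_comp_adjoint_eq {J : V →L[ℂ] X} {L : W →L[ℂ] X}
    (h : ∀ f, J (adjoint J f) = L (adjoint L f)) (hL : Function.Injective L) :
    Set.range L ⊆ Set.range J := by
  rintro _ ⟨z, rfl⟩
  have hn : ∀ f, ‖adjoint J f‖ = ‖adjoint L f‖ := by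
    intro f
    have e1 : ⟪adjoint J f, adjoint J f⟫_ℂ = ⟪adjoint L f, adjoint L f⟫_ℂ := by
      rw [ContinuousLinearMap.adjoint_inner_left, ContinuousLinearMap.adjoint_inner_left, h]
    rw [norm_eq_sqrt_re_inner (𝕜 := ℂ), norm_eq_sqrt_re_inner (𝕜 := ℂ), e1]
  obtain ⟨f, hf⟩ : ∃ f : ℕ → X, Tendsto (fun n => adjoint L (f n)) atTop (𝓝 z) := by
    obtain ⟨u, hu, huz⟩ := mem_closure_iff_seq_limit.1 (denseRange_adjoint_of_injective hL z)
    choose f hf using hu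
    exact ⟨f, by simpa only [hf] using huz⟩
  have hc : CauchySeq fun n => adjoint J (f n) := by
    have hcL := hf.cauchySeq
    rw [Metric.cauchySeq_iff] at hcL ⊢
    intro e he
    obtain ⟨M, hM⟩ := hcL e he
    refine ⟨M, fun m hm n hn' => ?_⟩
    have h1 := hM m hm n hn'
    rw [dist_eq_norm, ← map_sub] at h1 ⊢
    rwa [hn]
  obtain ⟨v, hv⟩ := cauchySeq_tendsto_of_complete hc
  refine ⟨v, tendsto_nhds_unique ((J.continuous.tendsto v).comp hv) ?_⟩
  refine ((L.continuous.tendsto z).comp hf).congr fun n => ?_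
  exact (h (f n)).symm

/-- If `A⁻¹ = J J†` with `J` injective and of dense range, then `A` has a nonnegative self-adjoint
square root, namely the inverse of `(J J†)^{1/2}`. -/
theorem exists_isNonnegSqrt {A : X →ₗ.[ℂ] X} {J : V →L[ℂ] X} (hJd : DenseRange J)
    (hA : ∀ x f, (x, f) ∈ A.graph ↔ x = J (adjoint J f)) : ∃ S, IsNonnegSqrt A S := by
  have hKpos : 0 ≤ J ∘L adjoint J := by
    rw [ContinuousLinearMap.nonneg_iff_isPositive]
    exact ContinuousLinearMap.isPositive_self_comp_adjoint J
  set R : X →L[ℂ] X := CFC.sqrt (J ∘L adjoint J) with hR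
  have hRR : ∀ f, R (R f) = J (adjoint J f) := fun f =>
    DFunLike.congr_fun (CFC.sqrt_mul_sqrt_self (J ∘L adjoint J) hKpos) f
  have hRpos : R.IsPositive := by
    rw [← ContinuousLinearMap.nonneg_iff_isPositive]
    exact CFC.sqrt_nonneg _
  have hRsym : ∀ x y, ⟪R x, y⟫_ℂ = ⟪x, R y⟫_ℂ := hRpos.inner_left_eq_inner_right
  have hRinj : ∀ x, R x = 0 → x = 0 := by
    intro x hx
    have h1 : ⟪adjoint J x, adjoint J x⟫_ℂ = 0 := by
      rw [ContinuousLinearMap.adjoint_inner_left, ← hRR, hx, map_zero, inner_zero_right]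
    refine Dense.eq_zero_of_inner_left ℂ (S := Set.range J) hJd ?_
    rintro _ ⟨w, rfl⟩
    rw [← ContinuousLinearMap.adjoint_inner_left, inner_self_eq_zero.1 h1, inner_zero_left]
  let G : Submodule ℂ (X × X) := LinearMap.range
    ((R : X →ₗ[ℂ] X).prod LinearMap.id)
  have hG : ∀ x y, (x, y) ∈ G ↔ x = R y := by
    intro x y
    constructor
    · rintro ⟨z, hz⟩
      obtain ⟨h1, h2⟩ := Prod.ext_iff.1 hz
      change R z = x at h1
      change z = y at h2
      rw [← h1, h2]
    · rintro rfl
      exact ⟨y, rfl⟩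
  have hGu : ∀ q ∈ G, q.1 = 0 → q.2 = 0 := by
    rintro ⟨x, y⟩ hq h0
    exact hRinj y (((hG x y).1 hq).symm.trans h0)
  have hS : ∀ x y, (x, y) ∈ G.toLinearPMap.graph ↔ x = R y := by
    intro x y
    rw [Submodule.toLinearPMap_graph_eq G hGu, hG]
  have hdom : Dense (G.toLinearPMap.domain : Set X) := by
    refine (Submodule.dense_iff_topologicalClosure_eq_top).2 ?_
    rw [Submodule.topologicalClosure_eq_top_iff, Submodule.eq_bot_iff]
    intro z hz
    refine hRinj z (ext_inner_left ℂ fun y => ?_)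
    rw [← hRsym, inner_zero_right]
    exact hz _ (LinearPMap.mem_domain_of_mem_graph ((hS (R y) y).2 rfl))
  refine ⟨G.toLinearPMap, ⟨?_, fun x => ?_, fun x y => ?_⟩⟩
  · rw [LinearPMap.isSelfAdjoint_def]
    apply LinearPMap.eq_of_eq_graph
    rw [LinearPMap.adjoint_graph_eq_graph_adjoint hdom]
    ext ⟨x, y⟩
    rw [Submodule.mem_adjoint_iff, hS]
    constructor
    · intro h
      refine ext_inner_left ℂ fun z => ?_
      have h1 := h _ _ ((hS (R z) z).2 rfl)
      rw [sub_eq_zero] at h1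
      exact h1.trans (hRsym _ _)
    · rintro rfl a b hab
      rw [(hS a b).1 hab, hRsym, sub_self]
  · have h1 := (hS _ _).1 (LinearPMap.mem_graph G.toLinearPMap x)
    rw [h1]
    exact hRpos.re_inner_nonneg_right _
  · rw [hA]
    constructor
    · rintro rfl
      exact ⟨R y, (hS _ _).2 (hRR y).symm, (hS _ _).2 rfl⟩
    · rintro ⟨z, hz1, hz2⟩
      rw [(hS _ _).1 hz1, (hS _ _).1 hz2, hRR]

/-- If `A⁻¹ = J J†` with `J` injective, then every nonnegative self-adjoint square root of `A` has
domain `range J`. -/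
theorem IsNonnegSqrt.domain_eq_range {A S : X →ₗ.[ℂ] X} (hS : IsNonnegSqrt A S) {J : V →L[ℂ] X}
    (hJ : Function.Injective J)
    (hA : ∀ x f, (x, f) ∈ A.graph ↔ x = J (adjoint J f)) : (S.domain : Set X) = Set.range J := by
  have hdom : Dense (S.domain : Set X) := hS.selfAdjoint.dense_domain
  have hsym : ∀ x y x' y', (x, y) ∈ S.graph → (x', y') ∈ S.graph → ⟪y, x'⟫_ℂ = ⟪x, y'⟫_ℂ := by
    intro x y x' y' h h'
    have hadj : S.graph = S.graph.adjoint := by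
      rw [← LinearPMap.adjoint_graph_eq_graph_adjoint hdom,
        LinearPMap.isSelfAdjoint_def.1 hS.selfAdjoint]
    rw [hadj, Submodule.mem_adjoint_iff] at h'
    exact sub_eq_zero.1 (h' x y h)
  have hinj : ∀ x, (x, (0 : X)) ∈ S.graph → x = 0 := by
    intro x hx
    have h := (hS.sq x 0).2 ⟨0, hx, Submodule.zero_mem _⟩
    rwa [hA, map_zero, map_zero] at h
  have hsurj : ∀ y, ∃ z, (z, y) ∈ S.graph := by
    intro y
    obtain ⟨z, -, hz⟩ := (hS.sq _ y).1 ((hA _ y).2 rfl)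
    exact ⟨z, hz⟩
  choose r hr using hsurj
  have hru : ∀ z y, (z, y) ∈ S.graph → z = r y := by
    intro z y h
    have h1 := Submodule.sub_mem _ h (hr y)
    rw [Prod.mk_sub_mk, sub_self] at h1
    exact sub_eq_zero.1 (hinj _ h1)
  -- by the Hellinger–Toeplitz theorem, the inverse of `S` is bounded
  let R₀ : X →ₗ[ℂ] X :=
    { toFun := r
      map_add' := fun y z => (hru _ _ (Submodule.add_mem _ (hr y) (hr z))).symm
      map_smul' := fun k y => (hru _ _ (Submodule.smul_mem _ k (hr y))).symm }
  have hR₀ : R₀.IsSymmetric := fun y z => (hsym _ _ _ _ (hr y) (hr z)).symm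
  let R : X →L[ℂ] X := ⟨R₀, hR₀.continuous⟩
  have hRadj : adjoint R = R := ((ContinuousLinearMap.eq_adjoint_iff R R).2 hR₀).symm
  have hRinj : Function.Injective R := by
    refine (injective_iff_map_eq_zero R).2 fun y hy => ?_
    have h := hr y
    rw [show r y = 0 from hy] at h
    exact LinearPMap.graph_fst_eq_zero_snd S h rfl
  have hRR : ∀ f, R (adjoint R f) = J (adjoint J f) := by
    intro f
    obtain ⟨z, h1, h2⟩ := (hS.sq _ f).1 ((hA _ f).2 rfl)
    rw [hRadj, hru _ _ h1, hru _ _ h2]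
    rfl
  have hrange : (S.domain : Set X) = Set.range R := by
    ext x
    constructor
    · intro hx
      exact ⟨_, (hru _ _ (LinearPMap.mem_graph S ⟨x, hx⟩)).symm⟩
    · rintro ⟨y, rfl⟩
      exact LinearPMap.mem_domain_of_mem_graph (hr y)
  rw [hrange]
  exact (range_le_range_of_comp_adjoint_eq (fun f => (hRR f).symm) hRinj).antisymm
    (range_le_range_of_comp_adjoint_eq hRR hJ)

/-- A positive coercive operator `T` on `V` has an invertible self-adjoint `Q` with
`Q² = T⁻¹`. -/
theorem exists_inverse_sqrt {T : V →L[ℂ] V} (hTsym : ∀ v w, ⟪T v, w⟫_ℂ = ⟪v, T w⟫_ℂ)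
    {k : ℝ} (hk : 0 < k) (hT : ∀ v, k * ‖v‖ ^ 2 ≤ (⟪T v, v⟫_ℂ).re) :
    ∃ Q : V →L[ℂ] V, adjoint Q = Q ∧ Function.Bijective Q ∧ (∀ v, T (Q (Q v)) = v) ∧
      ∀ v, Q (Q (T v)) = v := by
  obtain ⟨u, hu⟩ := isUnit_of_coercive hk hT
  have h1 : ∀ v, T ((↑u⁻¹ : V →L[ℂ] V) v) = v := fun v => by
    have := DFunLike.congr_fun u.mul_inv v
    rwa [hu] at this
  have h2 : ∀ v, (↑u⁻¹ : V →L[ℂ] V) (T v) = v := fun v => by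
    have := DFunLike.congr_fun u.inv_mul v
    rwa [hu] at this
  have hpos : 0 ≤ (↑u⁻¹ : V →L[ℂ] V) := by
    rw [ContinuousLinearMap.nonneg_iff_isPositive, ContinuousLinearMap.isPositive_def]
    refine ⟨fun v w => ?_, fun v => ?_⟩
    · change ⟪(↑u⁻¹ : V →L[ℂ] V) v, w⟫_ℂ = ⟪v, (↑u⁻¹ : V →L[ℂ] V) w⟫_ℂ
      conv_lhs => rw [← h1 w]
      rw [← hTsym, h1]
    · rw [ContinuousLinearMap.reApplyInnerSelf_apply]
      set w := (↑u⁻¹ : V →L[ℂ] V) v with hw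
      have hv : v = T w := by rw [hw, h1]
      rw [hv, ← hTsym]
      exact (by positivity : 0 ≤ k * ‖w‖ ^ 2).trans (hT w)
  have hQQ : ∀ v, CFC.sqrt (↑u⁻¹ : V →L[ℂ] V) (CFC.sqrt (↑u⁻¹ : V →L[ℂ] V) v) =
      (↑u⁻¹ : V →L[ℂ] V) v := fun v =>
    DFunLike.congr_fun (CFC.sqrt_mul_sqrt_self (↑u⁻¹ : V →L[ℂ] V) hpos) v
  have hQpos : (CFC.sqrt (↑u⁻¹ : V →L[ℂ] V)).IsPositive := by
    rw [← ContinuousLinearMap.nonneg_iff_isPositive]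
    exact CFC.sqrt_nonneg _
  refine ⟨CFC.sqrt (↑u⁻¹ : V →L[ℂ] V), hQpos.isSelfAdjoint.adjoint_eq, ⟨?_, fun v => ?_⟩,
    fun v => by rw [hQQ, h1], fun v => by rw [hQQ, h2]⟩
  · refine (injective_iff_map_eq_zero _).2 fun v hv => ?_
    have h := hQQ v
    rw [hv, map_zero] at h
    rw [← h1 v, ← h, map_zero]
  · exact ⟨CFC.sqrt (↑u⁻¹ : V →L[ℂ] V) (T v), by rw [hQQ, h2]⟩

/-- The domain of the square root of the operator defined by a coercive Hermitian form
`(v, w) ↦ ⟪T v, w⟫` on `V`, embedded in `X` by `p`, is the form domain `range p`. -/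
theorem sqrtDomain_eq_range {A : X →ₗ.[ℂ] X} {p : V →L[ℂ] X} (hp : Function.Injective p)
    (hpd : DenseRange p) {T : V →L[ℂ] V} (hTsym : ∀ v w, ⟪T v, w⟫_ℂ = ⟪v, T w⟫_ℂ)
    {k : ℝ} (hk : 0 < k) (hT : ∀ v, k * ‖v‖ ^ 2 ≤ (⟪T v, v⟫_ℂ).re)
    (hA : ∀ x f, (x, f) ∈ A.graph ↔ ∃ v, p v = x ∧ T v = adjoint p f) :
    (sqrtDomain A : Set X) = Set.range p := by
  obtain ⟨Q, hQadj, hQ, hTQ, hQT⟩ := exists_inverse_sqrt hTsym hk hT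
  have hrange : Set.range (p ∘L Q) = Set.range p := by
    rw [ContinuousLinearMap.coe_comp, hQ.2.range_comp]
  have hadj : ∀ f, adjoint (p ∘L Q) f = Q (adjoint p f) := fun f => by
    rw [ContinuousLinearMap.adjoint_comp, hQadj]; rfl
  have hA' : ∀ x f, (x, f) ∈ A.graph ↔ x = (p ∘L Q) (adjoint (p ∘L Q) f) := by
    intro x f
    rw [hA, hadj, ContinuousLinearMap.comp_apply]
    constructor
    · rintro ⟨v, rfl, hv⟩
      rw [← hv, hQT]
    · rintro rfl
      exact ⟨_, rfl, hTQ _⟩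
  have hd : DenseRange (p ∘L Q) := by
    rw [DenseRange, hrange]; exact hpd
  have hex := exists_isNonnegSqrt hd hA'
  rw [sqrtDomain, dif_pos hex, ← hrange]
  exact hex.choose_spec.domain_eq_range (hp.comp hQ.1) hA'

end Form

/-! ### Periodic coefficients as multiplication operators -/

section Periodic

variable {N : ℕ}

theorem ae_coord_ne_int :
    ∀ᵐ y : EuclideanSpace ℝ (Fin N), ∀ (i : Fin N) (m : ℤ), y i ≠ m := by
  rw [ae_all_iff]
  intro i
  rw [ae_all_iff]
  intro m
  have h : ∀ᵐ z : Fin N → ℝ, z i ≠ m := by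
    rw [volume_pi, ae_iff]
    simpa using Measure.pi_hyperplane (fun _ : Fin N => (volume : Measure ℝ)) i (m : ℝ)
  exact (PiLp.volume_preserving_ofLp (Fin N)).quasiMeasurePreserving.ae h

/-- A property of a periodic function that holds almost everywhere in the cell holds almost
everywhere. -/
theorem IsCellPeriodic.ae_of_ae_unitCell {β : Type*} {f : EuclideanSpace ℝ (Fin N) → β}
    (hf : IsCellPeriodic f) {P : β → Prop} (h : ∀ᵐ y ∂volume.restrict (unitCell N), P (f y)) :
    ∀ᵐ y, P (f y) := by
  have h1 : ∀ k : Fin N → ℤ, ∀ᵐ y : EuclideanSpace ℝ (Fin N),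
      y + WithLp.toLp 2 (fun i => (k i : ℝ)) ∈ unitCell N → P (f y) := by
    intro k
    have h2 := (measurePreserving_add_right (volume : Measure (EuclideanSpace ℝ (Fin N)))
      (WithLp.toLp 2 fun i => (k i : ℝ))).quasiMeasurePreserving.ae (ae_imp_of_ae_restrict h)
    filter_upwards [h2] with y hy hmem
    rw [← hf k y]
    exact hy hmem
  filter_upwards [ae_all_iff.2 h1, ae_coord_ne_int] with y hy hint
  refine hy (fun i => -⌊y i⌋) fun i => ?_
  have e : (y + WithLp.toLp 2 fun i => ((-⌊y i⌋ : ℤ) : ℝ)) i = Int.fract (y i) := by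
    rw [PiLp.add_apply, ← Int.self_sub_floor]
    simp [sub_eq_add_neg]
  rw [e]
  refine ⟨lt_of_le_of_ne (Int.fract_nonneg _) fun h0 => ?_, Int.fract_lt_one _⟩
  have h3 := Int.floor_add_fract (y i)
  rw [← h0, add_zero] at h3
  exact hint i _ h3.symm

theorem IsCellPeriodic.ae_rescaled {β : Type*} {f : EuclideanSpace ℝ (Fin N) → β}
    (hf : IsCellPeriodic f) {P : β → Prop} (h : ∀ᵐ y ∂volume.restrict (unitCell N), P (f y))
    {ε : ℝ} (hε : 0 < ε) (Ω : Opens (EuclideanSpace ℝ (Fin N))) :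
    ∀ᵐ x ∂volume.restrict Ω, P (f (ε⁻¹ • x)) := by
  have hq : Measure.QuasiMeasurePreserving (fun x : EuclideanSpace ℝ (Fin N) => ε⁻¹ • x)
      volume volume := by
    refine ⟨measurable_const_smul _, ?_⟩
    rw [Measure.map_addHaar_smul _ (inv_ne_zero hε.ne')]
    exact Measure.smul_absolutelyContinuous
  exact ae_restrict_of_ae (hq.ae (hf.ae_of_ae_unitCell h))

end Periodic

section Multiplication

variable {Y F : Type*} [MeasurableSpace Y] {μ : Measure Y} [NormedAddCommGroup F]
  [InnerProductSpace ℂ F]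

theorem norm_sq_eq_integral (u : Lp F 2 μ) : ‖u‖ ^ 2 = ∫ x, ‖u x‖ ^ 2 ∂μ := by
  rw [← inner_self_eq_norm_sq (𝕜 := ℂ) u, MeasureTheory.L2.inner_def,
    ← integral_re (MeasureTheory.L2.integrable_inner (𝕜 := ℂ) u u)]
  simp only [inner_self_eq_norm_sq]

/-- Multiplication by a bounded measurable field `M` of operators on `F` is a bounded operator on
`L²(μ; F)`; pointwise symmetry and coercivity pass to it. -/
theorem exists_multiplication_operator {M : Y → F →L[ℂ] F} (hM : AEStronglyMeasurable M μ) {C k : ℝ}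
    (hC : ∀ᵐ x ∂μ, ‖M x‖ ≤ C) (hsym : ∀ᵐ x ∂μ, ∀ v w : F, ⟪M x v, w⟫_ℂ = ⟪v, M x w⟫_ℂ)
    (hk : ∀ᵐ x ∂μ, ∀ v : F, k * ‖v‖ ^ 2 ≤ (⟪M x v, v⟫_ℂ).re) :
    ∃ L : Lp F 2 μ →L[ℂ] Lp F 2 μ, (∀ u, ∀ᵐ x ∂μ, L u x = M x (u x)) ∧
      (∀ u w, ⟪L u, w⟫_ℂ = ⟪u, L w⟫_ℂ) ∧ ∀ u, k * ‖u‖ ^ 2 ≤ (⟪L u, u⟫_ℂ).re := by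
  let m : Lp (F →L[ℂ] F) ⊤ μ := (memLp_top_of_bound hM C hC).toLp M
  have hm : ∀ᵐ x ∂μ, m x = M x := MemLp.coeFn_toLp _
  let L : Lp F 2 μ →L[ℂ] Lp F 2 μ :=
    ContinuousLinearMap.holderL μ ⊤ 2 2 (ContinuousLinearMap.id ℂ (F →L[ℂ] F)) m
  have hL : ∀ u, ∀ᵐ x ∂μ, L u x = M x (u x) := by
    intro u
    filter_upwards [hm, ContinuousLinearMap.coeFn_holder (r := 2)
      (ContinuousLinearMap.id ℂ (F →L[ℂ] F)) m u] with x h1 h2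
    change (ContinuousLinearMap.holder 2 (ContinuousLinearMap.id ℂ (F →L[ℂ] F)) m u) x = _
    rw [h2, h1]; rfl
  refine ⟨L, hL, fun u w => ?_, fun u => ?_⟩
  · rw [MeasureTheory.L2.inner_def, MeasureTheory.L2.inner_def]
    refine integral_congr_ae ?_
    filter_upwards [hL u, hL w, hsym] with x h1 h2 h3
    rw [h1, h2, h3]
  · have e1 : k * ‖u‖ ^ 2 = ∫ x, k * ‖u x‖ ^ 2 ∂μ := by
      rw [norm_sq_eq_integral, integral_const_mul]
    have e2 : (⟪L u, u⟫_ℂ).re = ∫ x, (⟪L u x, u x⟫_ℂ).re ∂μ := by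
      rw [MeasureTheory.L2.inner_def]
      exact (integral_re (MeasureTheory.L2.integrable_inner (𝕜 := ℂ) (L u) u)).symm
    rw [e1, e2]
    refine integral_mono_ae ?_ (MeasureTheory.L2.integrable_inner (𝕜 := ℂ) (L u) u).re ?_
    · exact ((Lp.memLp u).integrable_norm_pow two_ne_zero).const_mul k
    · filter_upwards [hL u, hk] with x h1 h2
      change k * ‖u x‖ ^ 2 ≤ (⟪L u x, u x⟫_ℂ).re
      rw [h1]
      exact h2 _

end Multiplication

section Coefficients

variable {N : ℕ}

/-- The operator `ξ ↦ A ξ` on `ℂ^N` given by a real matrix `A`. -/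
def realMatrixCLM (A : Matrix (Fin N) (Fin N) ℝ) :
    EuclideanSpace ℂ (Fin N) →L[ℂ] EuclideanSpace ℂ (Fin N) :=
  ∑ i, ∑ j, (A i j : ℂ) • (EuclideanSpace.proj (𝕜 := ℂ) j).smulRight (EuclideanSpace.single i 1)

theorem realMatrixCLM_apply (A : Matrix (Fin N) (Fin N) ℝ) (v : EuclideanSpace ℂ (Fin N))
    (i : Fin N) : realMatrixCLM A v i = ∑ j, (A i j : ℂ) * v j := by
  have h : realMatrixCLM A v i =
      ∑ p, ∑ q, (A p q : ℂ) * (v q * (Pi.single p 1 : Fin N → ℂ) i) := by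
    simp [realMatrixCLM]
  rw [h, Finset.sum_eq_single i]
  · simp
  · intro p _ hp
    simp [Pi.single_eq_of_ne hp.symm]
  · simp

theorem inner_realMatrixCLM (A : Matrix (Fin N) (Fin N) ℝ) (v w : EuclideanSpace ℂ (Fin N)) :
    ⟪v, realMatrixCLM A w⟫_ℂ = ∑ i, ∑ j, (A i j : ℂ) * w j * starRingEnd ℂ (v i) := by
  rw [PiLp.inner_apply]
  refine Finset.sum_congr rfl fun i _ => ?_
  rw [realMatrixCLM_apply, RCLike.inner_apply, Finset.sum_mul]

theorem realMatrixCLM_symm {A : Matrix (Fin N) (Fin N) ℝ} (hA : A.IsSymm)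
    (v w : EuclideanSpace ℂ (Fin N)) : ⟪realMatrixCLM A v, w⟫_ℂ = ⟪v, realMatrixCLM A w⟫_ℂ := by
  rw [← inner_conj_symm, inner_realMatrixCLM, inner_realMatrixCLM, Finset.sum_comm]
  simp only [map_sum, map_mul, Complex.conj_ofReal, Complex.conj_conj]
  refine Finset.sum_congr rfl fun i _ => Finset.sum_congr rfl fun j _ => ?_
  rw [hA.apply i j]
  ring

theorem realMatrixCLM_coercive {A : Matrix (Fin N) (Fin N) ℝ} {α : ℝ}
    (hA : ∀ ξ : Fin N → ℝ, α * (∑ i, ξ i ^ 2) ≤ ∑ i, ∑ j, ξ i * A i j * ξ j)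
    (v : EuclideanSpace ℂ (Fin N)) : α * ‖v‖ ^ 2 ≤ (⟪v, realMatrixCLM A v⟫_ℂ).re := by
  have h1 := hA fun i => (v i).re
  have h2 := hA fun i => (v i).im
  have e1 : ‖v‖ ^ 2 = ∑ i, (v i).re ^ 2 + ∑ i, (v i).im ^ 2 := by
    rw [EuclideanSpace.norm_sq_eq, ← Finset.sum_add_distrib]
    refine Finset.sum_congr rfl fun i _ => ?_
    rw [← Complex.normSq_eq_norm_sq, Complex.normSq_apply]
    ring
  have e2 : (⟪v, realMatrixCLM A v⟫_ℂ).re = (∑ i, ∑ j, (v i).re * A i j * (v j).re) +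
      ∑ i, ∑ j, (v i).im * A i j * (v j).im := by
    rw [inner_realMatrixCLM, Complex.re_sum, ← Finset.sum_add_distrib]
    refine Finset.sum_congr rfl fun i _ => ?_
    rw [Complex.re_sum, ← Finset.sum_add_distrib]
    refine Finset.sum_congr rfl fun j _ => ?_
    simp
    ring
  rw [e1, e2, mul_add]
  exact add_le_add h1 h2

/-- The entries of a symmetric nonnegative matrix are bounded by any bound of its form. -/
theorem abs_entry_le_of_form_bounds {A : Matrix (Fin N) (Fin N) ℝ} {K : ℝ} (hs : A.IsSymm)
    (h0 : ∀ ξ : Fin N → ℝ, 0 ≤ ∑ i, ∑ j, ξ i * A i j * ξ j)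
    (h1 : ∀ ξ : Fin N → ℝ, ∑ i, ∑ j, ξ i * A i j * ξ j ≤ K * ∑ i, ξ i ^ 2) (i j : Fin N) :
    |A i j| ≤ K := by
  -- polarization: evaluate the form at `eᵢ ± eⱼ`
  have key : ∀ s t : ℝ, ∑ p, ∑ q, (Pi.single i s + Pi.single j t : Fin N → ℝ) p * A p q *
      (Pi.single i s + Pi.single j t : Fin N → ℝ) q =
      s ^ 2 * A i i + 2 * s * t * A i j + t ^ 2 * A j j := by
    intro s t
    have hji : A j i = A i j := hs.apply i j
    simp only [Pi.add_apply, add_mul, mul_add, Finset.sum_add_distrib]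
    simp only [Pi.single_apply, mul_ite, ite_mul, mul_zero, zero_mul, Finset.sum_ite_eq',
      Finset.mem_univ, if_true]
    rw [hji]
    ring
  have hdiag : ∀ p, A p p ≤ K := by
    intro p
    have h := h1 (Pi.single p 1)
    simpa [Pi.single_apply] using h
  have e1 := h0 (Pi.single i 1 + Pi.single j 1)
  have e2 := h0 (Pi.single i 1 + Pi.single j (-1))
  rw [key] at e1 e2
  have := hdiag i
  have := hdiag j
  rw [abs_le]
  constructor <;> linarith

theorem realMatrixCLM_norm_le {A : Matrix (Fin N) (Fin N) ℝ} {K : ℝ} (hA : ∀ i j, |A i j| ≤ K) :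
    ‖realMatrixCLM A‖ ≤ ∑ i : Fin N, ∑ j : Fin N,
      K * ‖(EuclideanSpace.proj (𝕜 := ℂ) j).smulRight (EuclideanSpace.single i (1 : ℂ))‖ := by
  refine norm_sum_le_of_le _ fun i _ => norm_sum_le_of_le _ fun j _ => ?_
  rw [norm_smul, Complex.norm_real, Real.norm_eq_abs]
  gcongr
  exact hA i j

variable (Ω : Opens (EuclideanSpace ℝ (Fin N))) {ε : ℝ}

/-- The flux `G ↦ a(·/ε) G` as a symmetric coercive bounded operator on `L²(Ω)^N`. -/
theorem IsEllipticCoeff.exists_operator {α : ℝ} (hα : 0 < α)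
    {a : EuclideanSpace ℝ (Fin N) → Matrix (Fin N) (Fin N) ℝ} (ha : IsEllipticCoeff α a)
    (hε : 0 < ε) :
    ∃ L : L2Vec Ω →L[ℂ] L2Vec Ω,
      (∀ G, ∀ᵐ x ∂volume.restrict Ω, L G x = realMatrixCLM (a (ε⁻¹ • x)) (G x)) ∧
      (∀ G H, ⟪L G, H⟫_ℂ = ⟪G, L H⟫_ℂ) ∧ ∀ G, α * ‖G‖ ^ 2 ≤ (⟪L G, G⟫_ℂ).re := by
  have hs := ha.periodic.ae_rescaled ha.symm hε Ω
  have hl := ha.periodic.ae_rescaled (P := fun A : Matrix (Fin N) (Fin N) ℝ => ∀ ξ : Fin N → ℝ,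
    α * (∑ i, ξ i ^ 2) ≤ ∑ i, ∑ j, ξ i * A i j * ξ j) ha.lower hε Ω
  have hu := ha.periodic.ae_rescaled (P := fun A : Matrix (Fin N) (Fin N) ℝ => ∀ ξ : Fin N → ℝ,
    ∑ i, ∑ j, ξ i * A i j * ξ j ≤ α⁻¹ * (∑ i, ξ i ^ 2)) ha.upper hε Ω
  refine exists_multiplication_operator (M := fun x => realMatrixCLM (a (ε⁻¹ • x)))
    (C := ∑ i : Fin N, ∑ j : Fin N,
      α⁻¹ * ‖(EuclideanSpace.proj (𝕜 := ℂ) j).smulRight (EuclideanSpace.single i (1 : ℂ))‖)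
    ?_ ?_ ?_ ?_
  · refine Finset.aestronglyMeasurable_fun_sum _ fun i _ =>
      Finset.aestronglyMeasurable_fun_sum _ fun j _ => ?_
    have h1 : Measurable fun x : EuclideanSpace ℝ (Fin N) => (a (ε⁻¹ • x) i j : ℂ) :=
      Complex.measurable_ofReal.comp ((ha.measurable i j).comp (measurable_const_smul _))
    exact h1.aestronglyMeasurable.smul_const _
  · filter_upwards [hs, hl, hu] with x h1 h2 h3
    refine realMatrixCLM_norm_le (abs_entry_le_of_form_bounds h1 (fun ξ => ?_) h3)
    exact (mul_nonneg hα.le (Finset.sum_nonneg fun i _ => sq_nonneg _)).trans (h2 ξ)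
  · filter_upwards [hs] with x h1
    exact realMatrixCLM_symm h1
  · filter_upwards [hs, hl] with x h1 h2 v
    rw [realMatrixCLM_symm h1]
    exact realMatrixCLM_coercive h2 v

/-- Multiplication by `c(·/ε)` as a symmetric bounded operator on `L²(Ω)`, for a bounded periodic
function `c`. -/
theorem exists_scalar_operator {c : EuclideanSpace ℝ (Fin N) → ℝ} (hm : Measurable c)
    (hp : IsCellPeriodic c) {k K : ℝ} (hk : 0 ≤ k)
    (hb : ∀ᵐ y ∂volume.restrict (unitCell N), k ≤ c y ∧ c y ≤ K) (hε : 0 < ε) :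
    ∃ L : L2 Ω →L[ℂ] L2 Ω, (∀ u, ∀ᵐ x ∂volume.restrict Ω, L u x = (c (ε⁻¹ • x) : ℂ) * u x) ∧
      (∀ u w, ⟪L u, w⟫_ℂ = ⟪u, L w⟫_ℂ) ∧ ∀ u, k * ‖u‖ ^ 2 ≤ (⟪L u, u⟫_ℂ).re := by
  have hb' := hp.ae_rescaled (P := fun r => k ≤ r ∧ r ≤ K) hb hε Ω
  have hin : ∀ (r : ℝ) (v w : ℂ), ⟪(r : ℂ) * v, w⟫_ℂ = (r : ℂ) * ⟪v, w⟫_ℂ := by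
    intro r v w
    rw [← smul_eq_mul, inner_smul_left, Complex.conj_ofReal]
  refine exists_multiplication_operator
    (M := fun x => (c (ε⁻¹ • x) : ℂ) • ContinuousLinearMap.id ℂ ℂ)
    (C := K * ‖ContinuousLinearMap.id ℂ ℂ‖) ?_ ?_ ?_ ?_
  · have h1 : Measurable fun x : EuclideanSpace ℝ (Fin N) => (c (ε⁻¹ • x) : ℂ) :=
      Complex.measurable_ofReal.comp (hm.comp (measurable_const_smul _))
    exact h1.aestronglyMeasurable.smul_const _
  · filter_upwards [hb'] with x hx
    rw [norm_smul, Complex.norm_real, Real.norm_of_nonneg (hk.trans hx.1)]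
    gcongr
    exact hx.2
  · refine Eventually.of_forall fun x v w => ?_
    change ⟪(c (ε⁻¹ • x) : ℂ) * v, w⟫_ℂ = ⟪v, (c (ε⁻¹ • x) : ℂ) * w⟫_ℂ
    rw [hin, ← smul_eq_mul _ w, inner_smul_right]
  · filter_upwards [hb'] with x hx v
    change k * ‖v‖ ^ 2 ≤ (⟪(c (ε⁻¹ • x) : ℂ) * v, v⟫_ℂ).re
    rw [hin, Complex.re_ofReal_mul]
    have h := inner_self_eq_norm_sq (𝕜 := ℂ) v
    change (⟪v, v⟫_ℂ).re = _ at h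
    rw [h]
    gcongr
    exact hx.1

end Coefficients

/-! ### The Hilbert space `H¹₀(Ω)` -/

theorem comp_adjoint_eq_iff {X E V : Type*} [NormedAddCommGroup X] [InnerProductSpace ℂ X]
    [CompleteSpace X] [NormedAddCommGroup E] [InnerProductSpace ℂ E] [CompleteSpace E]
    [NormedAddCommGroup V] [InnerProductSpace ℂ V] [CompleteSpace V]
    (p : V →L[ℂ] X) (g : V →L[ℂ] E) (L : E →L[ℂ] E) (v : V) (f : X) :
    ContinuousLinearMap.adjoint g (L (g v)) = ContinuousLinearMap.adjoint p f ↔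
      ∀ w, ⟪g w, L (g v)⟫_ℂ = ⟪p w, f⟫_ℂ := by
  constructor
  · intro h w
    rw [← ContinuousLinearMap.adjoint_inner_right, h, ContinuousLinearMap.adjoint_inner_right]
  · intro h
    refine ext_inner_left ℂ fun w => ?_
    rw [ContinuousLinearMap.adjoint_inner_right, h, ContinuousLinearMap.adjoint_inner_right]

section Sobolev

variable {N : ℕ} {Ω : Opens (EuclideanSpace ℝ (Fin N))}

theorem testFunction_eq_zero (φ : 𝓓(Ω, ℂ)) {x : EuclideanSpace ℝ (Fin N)} (hx : x ∉ Ω) :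
    φ x = 0 := by
  by_contra hne
  exact hx (φ.tsupport_subset (subset_tsupport φ hne))

theorem partialD_eq_zero (φ : 𝓓(Ω, ℂ)) (i : Fin N) {x : EuclideanSpace ℝ (Fin N)} (hx : x ∉ Ω) :
    partialD i φ x = 0 := by
  have h : fderiv ℝ φ x = 0 := by
    by_contra hne
    exact hx (φ.tsupport_subset (support_fderiv_subset ℝ hne))
  rw [partialD, h]; rfl

theorem continuous_partialD (φ : 𝓓(Ω, ℂ)) (i : Fin N) : Continuous (partialD i φ) :=
  (φ.contDiff.continuous_fderiv (by simp)).clm_apply continuous_const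

theorem hasCompactSupport_partialD (φ : 𝓓(Ω, ℂ)) (i : Fin N) :
    HasCompactSupport (partialD i φ) :=
  (φ.hasCompactSupport.fderiv ℝ).comp_left (g := fun L : EuclideanSpace ℝ (Fin N) →L[ℝ] ℂ =>
    L (EuclideanSpace.single i 1)) rfl

theorem differentiable_testFunction (φ : 𝓓(Ω, ℂ)) : Differentiable ℝ φ :=
  φ.contDiff.differentiable (by simp)

/-- The conjugate of a test function is a test function. -/
theorem exists_conj_testFunction (φ : 𝓓(Ω, ℂ)) :
    ∃ ψ : 𝓓(Ω, ℂ), (∀ x, ψ x = starRingEnd ℂ (φ x)) ∧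
      ∀ i x, partialD i ψ x = starRingEnd ℂ (partialD i φ x) := by
  refine ⟨⟨fun x => starRingEnd ℂ (φ x), Complex.conjCLE.contDiff.comp φ.contDiff,
    φ.hasCompactSupport.comp_left (g := starRingEnd ℂ) (map_zero _),
    (closure_mono fun x hx => ?_).trans φ.tsupport_subset⟩, fun x => rfl, fun i x => ?_⟩
  · simpa [Function.mem_support] using hx
  · have h := (Complex.conjCLE.toContinuousLinearMap.hasFDerivAt).comp x
      (differentiable_testFunction φ x).hasFDerivAt
    change fderiv ℝ (fun x => starRingEnd ℂ (φ x)) x _ = _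
    have h' : fderiv ℝ (fun x => starRingEnd ℂ (φ x)) x =
        Complex.conjCLE.toContinuousLinearMap.comp (fderiv ℝ φ x) := h.fderiv
    rw [h']
    rfl

theorem continuous_integral_mul {h : EuclideanSpace ℝ (Fin N) → ℂ}
    (hh : MemLp h 2 ((volume : Measure (EuclideanSpace ℝ (Fin N))).restrict Ω)) :
    Continuous fun u : L2 Ω => ∫ x in Ω, u x * h x := by
  have e : (fun u : L2 Ω => ∫ x in Ω, u x * h x) = fun u => ⟪hh.star.toLp _, u⟫_ℂ := by
    funext u
    rw [MeasureTheory.L2.inner_def]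
    refine integral_congr_ae ?_
    filter_upwards [hh.star.coeFn_toLp] with x hx
    rw [hx, RCLike.inner_apply]
    simp
  rw [e]
  exact continuous_const.inner continuous_id

theorem exists_compLp {Y F F' : Type*} [MeasurableSpace Y] {μ : Measure Y} [NormedAddCommGroup F]
    [NormedSpace ℂ F] [NormedAddCommGroup F'] [NormedSpace ℂ F'] (l : F →L[ℂ] F') :
    ∃ Q : Lp F 2 μ →L[ℂ] Lp F' 2 μ, ∀ G, ∀ᵐ x ∂μ, Q G x = l (G x) :=
  ⟨l.compLpL 2 μ, fun G => l.coeFn_compLpL G⟩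

theorem exists_coordinate_operator (i : Fin N) : ∃ Q : L2Vec Ω →L[ℂ] L2 Ω,
    ∀ G, ∀ᵐ x ∂volume.restrict Ω, Q G x = G x i :=
  exists_compLp (EuclideanSpace.proj (𝕜 := ℂ) i)

theorem isClosed_weakGradGraph : IsClosed (weakGradGraph Ω : Set (L2 Ω × L2Vec Ω)) := by
  have e : (weakGradGraph Ω : Set (L2 Ω × L2Vec Ω)) = ⋂ (φ : 𝓓(Ω, ℂ)) (i : Fin N),
      {q | ∫ x in Ω, q.1 x * partialD i φ x = - ∫ x in Ω, q.2 x i * φ x} := by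
    ext q
    simp only [Set.mem_iInter]
    rfl
  rw [e]
  refine isClosed_iInter fun φ => isClosed_iInter fun i => isClosed_eq
    ((continuous_integral_mul (partialD_memLp φ i)).comp continuous_fst) ?_
  obtain ⟨Q, hQ⟩ := exists_coordinate_operator (Ω := Ω) i
  have e2 : (fun q : L2 Ω × L2Vec Ω => - ∫ x in Ω, q.2 x i * φ x) =
      fun q => - ∫ x in Ω, Q q.2 x * φ x := by
    funext q
    refine congrArg Neg.neg (integral_congr_ae ?_)
    filter_upwards [hQ q.2] with x hx
    rw [hx]
  rw [e2]
  exact ((continuous_integral_mul (testFunction_memLp φ)).comp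
    (Q.continuous.comp continuous_snd)).neg

theorem testGraph_le_weakGradGraph : testGraph Ω ≤ weakGradGraph Ω := by
  rintro ⟨u, G⟩ ⟨ψ, h1, h2⟩ φ i
  have e1 : ∫ x in Ω, u x * partialD i φ x = ∫ x, ψ x * partialD i φ x := by
    refine Eq.trans (integral_congr_ae ?_) (setIntegral_eq_integral_of_forall_compl_eq_zero
      fun x hx => by rw [testFunction_eq_zero ψ hx, zero_mul])
    filter_upwards [h1] with x hx
    rw [show u x = ψ x from hx]
  have e2 : ∫ x in Ω, G x i * φ x = ∫ x, partialD i ψ x * φ x := by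
    refine Eq.trans (integral_congr_ae ?_) (setIntegral_eq_integral_of_forall_compl_eq_zero
      fun x hx => by rw [testFunction_eq_zero φ hx, mul_zero])
    filter_upwards [h2] with x hx
    rw [show G x i = partialD i ψ x from hx i]
  change ∫ x in Ω, u x * partialD i φ x = - ∫ x in Ω, G x i * φ x
  rw [e1, e2]
  refine integral_mul_fderiv_eq_neg_fderiv_mul_of_integrable ?_ ?_ ?_
    (fun x _ => differentiable_testFunction ψ x) (fun x _ => differentiable_testFunction φ x)
  · exact ((continuous_partialD ψ i).mul φ.continuous).integrable_of_hasCompactSupport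
      φ.hasCompactSupport.mul_left
  · exact (ψ.continuous.mul (continuous_partialD φ i)).integrable_of_hasCompactSupport
      ψ.hasCompactSupport.mul_right
  · exact (ψ.continuous.mul φ.continuous).integrable_of_hasCompactSupport
      ψ.hasCompactSupport.mul_right

/-- The **Poincaré inequality** for test functions on a set of bounded width. It comes from
integrating the derivative of `xᵢ |φ|²`. -/
theorem integral_norm_sq_le_of_bounded {R : ℝ} (i : Fin N) (hR : ∀ x ∈ Ω, |x i| ≤ R)
    (φ : 𝓓(Ω, ℂ)) :
    ∫ x, ‖φ x‖ ^ 2 ≤ 4 * R ^ 2 * ∫ x, ‖partialD i φ x‖ ^ 2 := by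
  let e : EuclideanSpace ℝ (Fin N) := EuclideanSpace.single i 1
  have hd : ∀ x, HasFDerivAt (fun x : EuclideanSpace ℝ (Fin N) => x i * ‖φ x‖ ^ 2)
      (x i • (2 • (innerSL ℝ (φ x)).comp (fderiv ℝ φ x)) +
        ‖φ x‖ ^ 2 • (EuclideanSpace.proj (𝕜 := ℝ) i)) x := fun x =>
    (EuclideanSpace.proj (𝕜 := ℝ) i).hasFDerivAt.mul
      (differentiable_testFunction φ x).hasFDerivAt.norm_sq
  have hval : ∀ x, fderiv ℝ (fun x : EuclideanSpace ℝ (Fin N) => x i * ‖φ x‖ ^ 2) x e =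
      x i * (2 * ⟪φ x, partialD i φ x⟫_ℝ) + ‖φ x‖ ^ 2 := by
    intro x
    rw [(hd x).fderiv]
    change x i * (2 • ⟪φ x, partialD i φ x⟫_ℝ) + ‖φ x‖ ^ 2 * e i = _
    have he : e i = 1 := by simp [e]
    rw [he, mul_one, two_nsmul, two_mul]
  have hc1 : Continuous fun x => x i * (2 * ⟪φ x, partialD i φ x⟫_ℝ) + ‖φ x‖ ^ 2 :=
    ((EuclideanSpace.proj (𝕜 := ℝ) i).continuous.mul (continuous_const.mul
      (φ.continuous.inner (continuous_partialD φ i)))).add (φ.continuous.norm.pow 2)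
  have hn : HasCompactSupport fun x => ‖φ x‖ ^ 2 :=
    φ.hasCompactSupport.comp_left (g := fun z : ℂ => ‖z‖ ^ 2) (by simp)
  have hn' : HasCompactSupport fun x => ‖partialD i φ x‖ ^ 2 :=
    (hasCompactSupport_partialD φ i).comp_left (g := fun z : ℂ => ‖z‖ ^ 2) (by simp)
  have hi1 : Integrable fun x => ‖φ x‖ ^ 2 :=
    (φ.continuous.norm.pow 2).integrable_of_hasCompactSupport hn
  have hi2 : Integrable fun x => ‖partialD i φ x‖ ^ 2 :=
    ((continuous_partialD φ i).norm.pow 2).integrable_of_hasCompactSupport hn'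
  have hc2 : HasCompactSupport fun x => x i * (2 * ⟪φ x, partialD i φ x⟫_ℝ) + ‖φ x‖ ^ 2 :=
    φ.hasCompactSupport.mono fun x hx hφ => hx (by simp [hφ])
  have hi3 := hc1.integrable_of_hasCompactSupport (μ := volume) hc2
  have hzero : ∫ x, (x i * (2 * ⟪φ x, partialD i φ x⟫_ℝ) + ‖φ x‖ ^ 2) = 0 := by
    have h := integral_mul_fderiv_eq_neg_fderiv_mul_of_integrable (μ := volume)
      (f := fun _ : EuclideanSpace ℝ (Fin N) => (1 : ℝ))
      (g := fun x : EuclideanSpace ℝ (Fin N) => x i * ‖φ x‖ ^ 2) (v := e) (by simp)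
      (by simpa only [hval, one_mul] using hi3)
      (by
        simp only [one_mul]
        exact ((EuclideanSpace.proj (𝕜 := ℝ) i).continuous.mul
          (φ.continuous.norm.pow 2)).integrable_of_hasCompactSupport hn.mul_left)
      (fun x _ => differentiableAt_const _) (fun x _ => (hd x).differentiableAt)
    simpa only [hval, one_mul, fderiv_fun_const, Pi.zero_apply, zero_apply,
      zero_mul, integral_zero, neg_zero] using h
  have hle : ∀ x, (1 / 2) * ‖φ x‖ ^ 2 - 2 * R ^ 2 * ‖partialD i φ x‖ ^ 2 ≤
      x i * (2 * ⟪φ x, partialD i φ x⟫_ℝ) + ‖φ x‖ ^ 2 := by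
    intro x
    by_cases hx : x ∈ Ω
    · have h1 := abs_real_inner_le_norm (φ x) (partialD i φ x)
      have h2 : |x i * ⟪φ x, partialD i φ x⟫_ℝ| ≤ R * (‖φ x‖ * ‖partialD i φ x‖) := by
        rw [abs_mul]
        exact mul_le_mul (hR x hx) h1 (abs_nonneg _) ((abs_nonneg _).trans (hR x hx))
      have h3 := (abs_le.1 h2).1
      nlinarith [sq_nonneg (‖φ x‖ - 2 * R * ‖partialD i φ x‖)]
    · rw [testFunction_eq_zero φ hx, partialD_eq_zero φ i hx]
      simp
  have h := integral_mono ((hi1.const_mul (1 / 2)).sub (hi2.const_mul (2 * R ^ 2))) hi3 hle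
  rw [hzero] at h
  simp only [Pi.sub_apply] at h
  rw [integral_sub (hi1.const_mul _) (hi2.const_mul _), integral_const_mul, integral_const_mul]
    at h
  linarith

theorem exists_poincare_testGraph (hN : 0 < N)
    (hΩ : Bornology.IsBounded (Ω : Set (EuclideanSpace ℝ (Fin N)))) :
    ∃ C : ℝ, 0 ≤ C ∧ ∀ q ∈ testGraph Ω, ‖q.1‖ ^ 2 ≤ C * ‖q.2‖ ^ 2 := by
  obtain ⟨R, hR⟩ := hΩ.exists_norm_le
  refine ⟨4 * R ^ 2, by positivity, ?_⟩
  rintro ⟨u, G⟩ ⟨φ, h1, h2⟩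
  let i : Fin N := ⟨0, hN⟩
  have h := integral_norm_sq_le_of_bounded i
    (fun x hx => (PiLp.norm_apply_le x i).trans (hR x hx)) φ
  have e1 : ‖u‖ ^ 2 = ∫ x, ‖φ x‖ ^ 2 := by
    rw [norm_sq_eq_integral]
    refine Eq.trans (integral_congr_ae ?_) (setIntegral_eq_integral_of_forall_compl_eq_zero
      fun x hx => by simp [testFunction_eq_zero φ hx])
    filter_upwards [h1] with x hx
    rw [show u x = φ x from hx]
  have e2 : ∫ x, ‖partialD i φ x‖ ^ 2 ≤ ‖G‖ ^ 2 := by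
    rw [norm_sq_eq_integral, ← setIntegral_eq_integral_of_forall_compl_eq_zero
      (s := (Ω : Set (EuclideanSpace ℝ (Fin N))))]
    · refine integral_mono_ae ((partialD_memLp φ i).integrable_norm_pow two_ne_zero)
        ((Lp.memLp G).integrable_norm_pow two_ne_zero) ?_
      filter_upwards [h2] with x hx
      rw [← show G x i = partialD i φ x from hx i]
      have := PiLp.norm_apply_le (G x) i
      gcongr
    · intro x hx
      simp [partialD_eq_zero φ i hx]
  rw [e1]
  exact h.trans (by gcongr)

variable (Ω) in
/-- The closure of the pairs `(φ, ∇φ)`, as a closed subspace of the Hilbert sum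
`L²(Ω) ⊕ L²(Ω)^N`. It is `H¹₀(Ω)` with its Hilbert space structure. -/
abbrev closedTestGraph : Submodule ℂ (WithLp 2 (L2 Ω × L2Vec Ω)) :=
  (testGraph Ω).topologicalClosure.comap
    (WithLp.prodContinuousLinearEquiv 2 ℂ (L2 Ω) (L2Vec Ω)).toLinearEquiv.toLinearMap

instance : CompleteSpace (closedTestGraph Ω) := by
  refine IsComplete.completeSpace_coe (IsClosed.isComplete ?_)
  exact (testGraph Ω).isClosed_topologicalClosure.preimage
    (WithLp.prodContinuousLinearEquiv 2 ℂ (L2 Ω) (L2Vec Ω)).continuous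

namespace closedTestGraph

variable (Ω) in
/-- The embedding of `H¹₀(Ω)` in `L²(Ω)`. -/
def val : closedTestGraph Ω →L[ℂ] L2 Ω :=
  (WithLp.fstL 2 ℂ (L2 Ω) (L2Vec Ω)).comp (closedTestGraph Ω).subtypeL

variable (Ω) in
/-- The gradient on `H¹₀(Ω)`. -/
def nabla : closedTestGraph Ω →L[ℂ] L2Vec Ω :=
  (WithLp.sndL 2 ℂ (L2 Ω) (L2Vec Ω)).comp (closedTestGraph Ω).subtypeL

theorem mem_closure (v : closedTestGraph Ω) :
    (val Ω v, nabla Ω v) ∈ closure (testGraph Ω : Set (L2 Ω × L2Vec Ω)) := v.2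

/-- The element of `H¹₀(Ω)` given by a pair in the closure of the test graph. -/
def mk (q : L2 Ω × L2Vec Ω) (hq : q ∈ (testGraph Ω).topologicalClosure) : closedTestGraph Ω :=
  ⟨WithLp.toLp 2 q, hq⟩

theorem norm_sq (v : closedTestGraph Ω) : ‖v‖ ^ 2 = ‖val Ω v‖ ^ 2 + ‖nabla Ω v‖ ^ 2 :=
  WithLp.prod_norm_sq_eq_of_L2 (v : WithLp 2 (L2 Ω × L2Vec Ω))

theorem mem_weakGradGraph (v : closedTestGraph Ω) : (val Ω v, nabla Ω v) ∈ weakGradGraph Ω :=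
  (testGraph Ω).topologicalClosure_minimal testGraph_le_weakGradGraph isClosed_weakGradGraph
    (mem_closure v)

theorem nabla_eq_of_mem {v : closedTestGraph Ω} {G : L2Vec Ω}
    (h : (val Ω v, G) ∈ weakGradGraph Ω) : G = nabla Ω v := by
  have h1 := Submodule.sub_mem _ h (mem_weakGradGraph v)
  rw [Prod.mk_sub_mk, sub_self] at h1
  exact sub_eq_zero.1 (weakGradGraph_unique _ h1 rfl)

theorem grad_val (v : closedTestGraph Ω) : grad (val Ω v) = nabla Ω v := by
  have hg : (weakGradient Ω).graph = weakGradGraph Ω :=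
    Submodule.toLinearPMap_graph_eq _ weakGradGraph_unique
  have hm : val Ω v ∈ sobolevH1 Ω := by
    refine LinearPMap.mem_domain_of_mem_graph (f := weakGradient Ω) (y := nabla Ω v) ?_
    rw [hg]
    exact mem_weakGradGraph v
  rw [grad, dif_pos hm]
  refine nabla_eq_of_mem ?_
  have h := LinearPMap.mem_graph (weakGradient Ω) ⟨val Ω v, hm⟩
  rwa [hg] at h

theorem val_injective : Function.Injective (val Ω) := by
  refine (injective_iff_map_eq_zero _).2 fun v hv => ?_
  have h := weakGradGraph_unique _ (mem_weakGradGraph v) hv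
  have h2 := norm_sq v
  rw [hv, show nabla Ω v = 0 from h] at h2
  simpa using h2

theorem range_val : Set.range (val Ω) = sobolevH10 Ω := by
  ext u
  constructor
  · rintro ⟨v, rfl⟩
    exact ⟨_, mem_closure v, rfl⟩
  · rintro ⟨q, hq, rfl⟩
    exact ⟨mk q hq, rfl⟩

theorem exists_poincare (hN : 0 < N)
    (hΩ : Bornology.IsBounded (Ω : Set (EuclideanSpace ℝ (Fin N)))) :
    ∃ C : ℝ, 0 ≤ C ∧ ∀ v, ‖val Ω v‖ ^ 2 ≤ C * ‖nabla Ω v‖ ^ 2 := by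
  obtain ⟨C, hC, h⟩ := exists_poincare_testGraph hN hΩ
  refine ⟨C, hC, fun v => ?_⟩
  have hcl : IsClosed {q : L2 Ω × L2Vec Ω | ‖q.1‖ ^ 2 ≤ C * ‖q.2‖ ^ 2} :=
    isClosed_le (continuous_fst.norm.pow 2) (continuous_const.mul (continuous_snd.norm.pow 2))
  exact closure_minimal (fun q hq => h q hq) hcl (mem_closure v)

/-- The element of `H¹₀(Ω)` given by the conjugate of a test function. -/
theorem exists_conj (φ : 𝓓(Ω, ℂ)) : ∃ w : closedTestGraph Ω,
    (∀ᵐ x ∂volume.restrict Ω, val Ω w x = starRingEnd ℂ (φ x)) ∧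
    ∀ᵐ x ∂volume.restrict Ω, ∀ i, nabla Ω w x i = starRingEnd ℂ (partialD i φ x) := by
  obtain ⟨ψ, hψ, hψ'⟩ := exists_conj_testFunction φ
  have hm : MemLp (fun x => WithLp.toLp 2 fun i => partialD i ψ x : _ → EuclideanSpace ℂ (Fin N)) 2
      ((volume : Measure (EuclideanSpace ℝ (Fin N))).restrict Ω) :=
    MemLp.of_eval_piLp fun i => partialD_memLp ψ i
  have h1 := (testFunction_memLp ψ).coeFn_toLp
  have h2 := hm.coeFn_toLp
  refine ⟨mk ((testFunction_memLp ψ).toLp _, hm.toLp _)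
    ((testGraph Ω).le_topologicalClosure ⟨ψ, h1, ?_⟩), ?_, ?_⟩
  · filter_upwards [h2] with x hx i
    change hm.toLp _ x i = _
    rw [hx]
  · filter_upwards [h1] with x hx
    rw [← hψ]
    exact hx
  · filter_upwards [h2] with x hx i
    rw [← hψ']
    change hm.toLp _ x i = _
    rw [hx]

theorem inner_val_conj {φ : 𝓓(Ω, ℂ)} {w : closedTestGraph Ω}
    (hw : ∀ᵐ x ∂volume.restrict Ω, val Ω w x = starRingEnd ℂ (φ x)) (f : L2 Ω) :
    ⟪val Ω w, f⟫_ℂ = ∫ x in Ω, f x * φ x := by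
  rw [MeasureTheory.L2.inner_def]
  refine integral_congr_ae ?_
  filter_upwards [hw] with x hx
  rw [hx, RCLike.inner_apply, Complex.conj_conj]

theorem inner_nabla_conj {φ : 𝓓(Ω, ℂ)} {w : closedTestGraph Ω}
    (hw : ∀ᵐ x ∂volume.restrict Ω, ∀ i, nabla Ω w x i = starRingEnd ℂ (partialD i φ x))
    (σ : L2Vec Ω) :
    ⟪nabla Ω w, σ⟫_ℂ = ∫ x in Ω, ∑ i, σ x i * partialD i φ x := by
  rw [MeasureTheory.L2.inner_def]
  refine integral_congr_ae ?_
  filter_upwards [hw] with x hx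
  rw [PiLp.inner_apply]
  refine Finset.sum_congr rfl fun i _ => ?_
  rw [hx, RCLike.inner_apply, Complex.conj_conj]

/-- Elements of `H¹₀(Ω)` are determined by their inner products with test functions. -/
theorem ext_of_test {z z' : closedTestGraph Ω}
    (h : ∀ (φ : 𝓓(Ω, ℂ)) (w : closedTestGraph Ω),
      (∀ᵐ x ∂volume.restrict Ω, val Ω w x = starRingEnd ℂ (φ x)) →
      (∀ᵐ x ∂volume.restrict Ω, ∀ i, nabla Ω w x i = starRingEnd ℂ (partialD i φ x)) →
      ⟪w, z⟫_ℂ = ⟪w, z'⟫_ℂ) : z = z' := by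
  have hcl : IsClosed {q : L2 Ω × L2Vec Ω |
      ⟪WithLp.toLp 2 q, (z : WithLp 2 (L2 Ω × L2Vec Ω))⟫_ℂ =
        ⟪WithLp.toLp 2 q, (z' : WithLp 2 (L2 Ω × L2Vec Ω))⟫_ℂ} :=
    isClosed_eq ((WithLp.prod_continuous_toLp 2 _ _).inner continuous_const)
      ((WithLp.prod_continuous_toLp 2 _ _).inner continuous_const)
  refine ext_inner_left ℂ fun w => ?_
  refine closure_minimal ?_ hcl (mem_closure w)
  rintro q ⟨φ, h1, h2⟩
  obtain ⟨ψ, hψ, hψ'⟩ := exists_conj_testFunction φ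
  refine h ψ (mk q ((testGraph Ω).le_topologicalClosure ⟨φ, h1, h2⟩)) ?_ ?_
  · filter_upwards [h1] with x hx
    rw [hψ, Complex.conj_conj]
    exact hx
  · filter_upwards [h2] with x hx i
    rw [hψ', Complex.conj_conj]
    exact hx i

theorem denseRange_val : DenseRange (val Ω) := by
  have h : (val Ω).range.topologicalClosure = ⊤ := by
    rw [Submodule.topologicalClosure_eq_top_iff, Submodule.eq_bot_iff]
    intro f hf
    refine (Lp.eq_zero_iff_ae_eq_zero).2 (ae_eq_zero_of_test (Lp.memLp f) fun φ => ?_)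
    obtain ⟨w, hw, -⟩ := exists_conj φ
    rw [← inner_val_conj hw]
    exact hf _ ⟨w, rfl⟩
  exact (Submodule.dense_iff_topologicalClosure_eq_top).2 h

/-- The graph of the elliptic operator in terms of the form `⟪L ∇v, ∇w⟫` on `H¹₀(Ω)`. -/
theorem mem_ellipticOp_graph_iff {ε : ℝ}
    {a : EuclideanSpace ℝ (Fin N) → Matrix (Fin N) (Fin N) ℝ} {L : L2Vec Ω →L[ℂ] L2Vec Ω}
    (hL : ∀ G, ∀ᵐ x ∂volume.restrict Ω, L G x = realMatrixCLM (a (ε⁻¹ • x)) (G x))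
    (u f : L2 Ω) :
    (u, f) ∈ (ellipticOp Ω ε a).graph ↔
      ∃ v, val Ω v = u ∧ ∀ w, ⟪nabla Ω w, L (nabla Ω v)⟫_ℂ = ⟪val Ω w, f⟫_ℂ := by
  rw [ellipticOp, Submodule.toLinearPMap_graph_eq _ ellipticGraph_unique]
  have hcoord : ∀ G, ∀ᵐ x ∂volume.restrict Ω, ∀ i, L G x i =
      ∑ j, (a (ε⁻¹ • x) i j : ℂ) * G x j := by
    intro G
    filter_upwards [hL G] with x hx i
    rw [hx, realMatrixCLM_apply]
  constructor
  · rintro ⟨hu, G, σ, hG, hσ, h⟩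
    have hu' : u ∈ Set.range (val Ω) := by rw [range_val]; exact hu
    obtain ⟨v, rfl⟩ := hu'
    have hGv : G = nabla Ω v := nabla_eq_of_mem hG
    have hσL : σ = L (nabla Ω v) := by
      refine Lp.ext ?_
      filter_upwards [hσ, hcoord (nabla Ω v)] with x h1 h2
      ext i
      rw [h1, h2, hGv]
    refine ⟨v, rfl, (comp_adjoint_eq_iff _ _ _ _ _).1 (ext_of_test fun φ w hw1 hw2 => ?_)⟩
    rw [ContinuousLinearMap.adjoint_inner_right, ContinuousLinearMap.adjoint_inner_right,
      inner_val_conj hw1, inner_nabla_conj hw2, ← hσL]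
    exact h φ
  · rintro ⟨v, rfl, hv⟩
    refine ⟨?_, nabla Ω v, L (nabla Ω v), mem_weakGradGraph v, hcoord _, fun φ => ?_⟩
    · rw [← SetLike.mem_coe, ← range_val]
      exact ⟨v, rfl⟩
    · obtain ⟨w, hw1, hw2⟩ := exists_conj φ
      have h := hv w
      rw [inner_val_conj hw1, inner_nabla_conj hw2] at h
      exact h

end closedTestGraph

end Sobolev

/-! ### Solvability of the resolvent system -/

section Resolvent

variable {X E V : Type*} [NormedAddCommGroup X] [InnerProductSpace ℂ X] [CompleteSpace X]
  [NormedAddCommGroup E] [InnerProductSpace ℂ E] [CompleteSpace E]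
  [NormedAddCommGroup V] [InnerProductSpace ℂ V] [CompleteSpace V]

open ContinuousLinearMap (adjoint)

/-- Two coercive equations with a skew coupling `G` are uniquely solvable: eliminating the second
unknown leaves the coercive operator `S + G T⁻¹ G`. -/
theorem exists_solution_of_skew_coupling {S T G : V →L[ℂ] V} {k l : ℝ} (hk : 0 < k) (hl : 0 < l)
    (hS : ∀ v, k * ‖v‖ ^ 2 ≤ (⟪S v, v⟫_ℂ).re) (hT : ∀ v, l * ‖v‖ ^ 2 ≤ (⟪T v, v⟫_ℂ).re)
    (hG : ∀ v w, ⟪G v, w⟫_ℂ = ⟪v, G w⟫_ℂ) (f h : V) :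
    ∃ u θ, S u + G θ = f ∧ T θ - G u = h := by
  obtain ⟨t, ht⟩ := isUnit_of_coercive hl hT
  set R : V →L[ℂ] V := ↑t⁻¹ with hR
  have hTR : ∀ v, T (R v) = v := fun v => by
    have := DFunLike.congr_fun t.mul_inv v
    rwa [ht] at this
  have hco : ∀ v, k * ‖v‖ ^ 2 ≤ (⟪(S + G ∘L R ∘L G) v, v⟫_ℂ).re := by
    intro v
    have h1 : 0 ≤ (⟪R (G v), G v⟫_ℂ).re := by
      have h2 := hT (R (G v))
      rw [hTR, ← inner_conj_symm, Complex.conj_re] at h2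
      exact (by positivity : 0 ≤ l * ‖R (G v)‖ ^ 2).trans h2
    have h3 : ⟪(S + G ∘L R ∘L G) v, v⟫_ℂ = ⟪S v, v⟫_ℂ + ⟪R (G v), G v⟫_ℂ := by
      rw [← hG, ← inner_add_left]; rfl
    rw [h3, Complex.add_re]
    linarith [hS v]
  obtain ⟨s, hs⟩ := isUnit_of_coercive hk hco
  have hsol : ∀ v, (S + G ∘L R ∘L G) ((↑s⁻¹ : V →L[ℂ] V) v) = v := fun v => by
    have := DFunLike.congr_fun s.mul_inv v
    rwa [hs] at this
  set u := (↑s⁻¹ : V →L[ℂ] V) (f - G (R h)) with hu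
  refine ⟨u, R (h + G u), ?_, ?_⟩
  · have h1 : S u + G (R (G u)) = f - G (R h) := hsol (f - G (R h))
    rw [map_add, map_add, add_comm (G (R h)), ← add_assoc, h1, sub_add_cancel]
  · rw [hTR, add_sub_cancel_right]

theorem coercive_of_poincare {X : Type*} [NormedAddCommGroup X] [InnerProductSpace ℂ X] {p : V →L[ℂ] X} {g : V →L[ℂ] E}
    (hnorm : ∀ v, ‖v‖ ^ 2 = ‖p v‖ ^ 2 + ‖g v‖ ^ 2) {C : ℝ} (hC : 0 ≤ C)
    (hP : ∀ v, ‖p v‖ ^ 2 ≤ C * ‖g v‖ ^ 2) {L : E →L[ℂ] E} {α : ℝ} (hα : 0 < α)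
    (hL : ∀ G, α * ‖G‖ ^ 2 ≤ (⟪L G, G⟫_ℂ).re) (v : V) :
    α / (C + 1) * ‖v‖ ^ 2 ≤ (⟪adjoint g (L (g v)), v⟫_ℂ).re := by
  rw [ContinuousLinearMap.adjoint_inner_left]
  refine le_trans ?_ (hL (g v))
  have h := hP v
  rw [div_mul_eq_mul_div, div_le_iff₀ (by positivity), hnorm, mul_assoc]
  gcongr
  linarith

/-- The resolvent equation of the thermoelastic system in weak form. -/
theorem exists_weak_resolvent {p : V →L[ℂ] X} {g : V →L[ℂ] E}
    (hnorm : ∀ v, ‖v‖ ^ 2 = ‖p v‖ ^ 2 + ‖g v‖ ^ 2) {C : ℝ} (hC : 0 ≤ C)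
    (hP : ∀ v, ‖p v‖ ^ 2 ≤ C * ‖g v‖ ^ 2) {A B : E →L[ℂ] E} {c d γ : X →L[ℂ] X} {α : ℝ}
    (hα : 0 < α)
    (hA : ∀ G, α * ‖G‖ ^ 2 ≤ (⟪A G, G⟫_ℂ).re) (hB : ∀ G, α * ‖G‖ ^ 2 ≤ (⟪B G, G⟫_ℂ).re)
    (hc : ∀ u, α * ‖u‖ ^ 2 ≤ (⟪c u, u⟫_ℂ).re) (hd : ∀ u, α * ‖u‖ ^ 2 ≤ (⟪d u, u⟫_ℂ).re)
    (hγ : ∀ u w, ⟪γ u, w⟫_ℂ = ⟪u, γ w⟫_ℂ) {l : ℝ} (hl : 0 < l) (f : V) (q h : X) :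
    ∃ u v θ : V, (l : ℂ) • u - v = f ∧
      (∀ w, ⟪g w, A (g u)⟫_ℂ = -⟪p w, c ((l : ℂ) • p v - q) + γ (p θ)⟫_ℂ) ∧
      ∀ w, ⟪g w, B (g θ)⟫_ℂ = ⟪p w, γ (p v) - d ((l : ℂ) • p θ - h)⟫_ℂ := by
  -- with `v = l u - f`, and the first equation multiplied by `l`, the coupling becomes skew
  have hAp : ∀ v, α / (C + 1) * ‖v‖ ^ 2 ≤ (⟪adjoint g (A (g v)), v⟫_ℂ).re :=
    coercive_of_poincare hnorm hC hP hα hA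
  have hBp : ∀ v, α / (C + 1) * ‖v‖ ^ 2 ≤ (⟪adjoint g (B (g v)), v⟫_ℂ).re :=
    coercive_of_poincare hnorm hC hP hα hB
  have hpos : ∀ {m : X →L[ℂ] X}, (∀ u, α * ‖u‖ ^ 2 ≤ (⟪m u, u⟫_ℂ).re) → ∀ v,
      0 ≤ (⟪adjoint p (m (p v)), v⟫_ℂ).re := by
    intro m hm v
    rw [ContinuousLinearMap.adjoint_inner_left]
    exact (by positivity : 0 ≤ α * ‖p v‖ ^ 2).trans (hm (p v))
  have hkpos : 0 < α / (C + 1) := by positivity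
  obtain ⟨u, θ, h1, h2⟩ := exists_solution_of_skew_coupling
    (S := ((l ^ 3 : ℝ) : ℂ) • (adjoint p ∘L c ∘L p) + (l : ℂ) • (adjoint g ∘L A ∘L g))
    (T := (l : ℂ) • (adjoint p ∘L d ∘L p) + (adjoint g ∘L B ∘L g))
    (G := (l : ℂ) • (adjoint p ∘L γ ∘L p)) (mul_pos hl hkpos) hkpos
    (fun v => by
      have e : ⟪(((l ^ 3 : ℝ) : ℂ) • (adjoint p ∘L c ∘L p) +
          (l : ℂ) • (adjoint g ∘L A ∘L g)) v, v⟫_ℂ =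
          ((l ^ 3 : ℝ) : ℂ) * ⟪adjoint p (c (p v)), v⟫_ℂ +
            (l : ℂ) * ⟪adjoint g (A (g v)), v⟫_ℂ := by
        simp only [add_apply, smul_apply, ContinuousLinearMap.comp_apply, inner_add_left,
          inner_smul_left, Complex.conj_ofReal]
      rw [e, Complex.add_re, Complex.re_ofReal_mul, Complex.re_ofReal_mul]
      have n1 := mul_nonneg (pow_pos hl 3).le (hpos hc v)
      have n2 := mul_le_mul_of_nonneg_left (hAp v) hl.le
      linarith)
    (fun v => by
      have e : ⟪((l : ℂ) • (adjoint p ∘L d ∘L p) + (adjoint g ∘L B ∘L g)) v, v⟫_ℂ =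
          (l : ℂ) * ⟪adjoint p (d (p v)), v⟫_ℂ + ⟪adjoint g (B (g v)), v⟫_ℂ := by
        simp only [add_apply, smul_apply, ContinuousLinearMap.comp_apply, inner_add_left,
          inner_smul_left, Complex.conj_ofReal]
      rw [e, Complex.add_re, Complex.re_ofReal_mul]
      have n1 := mul_nonneg hl.le (hpos hd v)
      linarith [hBp v])
    (fun v w => by
      simp only [smul_apply, ContinuousLinearMap.comp_apply, inner_smul_left, inner_smul_right,
        Complex.conj_ofReal, ContinuousLinearMap.adjoint_inner_left,
        ContinuousLinearMap.adjoint_inner_right, hγ])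
    ((l : ℂ) • adjoint p (c q) + ((l ^ 2 : ℝ) : ℂ) • adjoint p (c (p f)))
    (adjoint p (d h) - adjoint p (γ (p f)))
  have hlne : (l : ℂ) ≠ 0 := by exact_mod_cast hl.ne'
  refine ⟨u, (l : ℂ) • u - f, θ, sub_sub_cancel _ _, fun w => ?_, fun w => ?_⟩
  · have h3 := congrArg (fun z => ⟪w, z⟫_ℂ) h1
    simp only [add_apply, smul_apply, ContinuousLinearMap.comp_apply, inner_add_right,
      inner_smul_right, ContinuousLinearMap.adjoint_inner_right] at h3
    simp only [map_sub, map_smul, inner_add_right, inner_sub_right, inner_smul_right, smul_sub]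
    push_cast at h3
    refine mul_left_cancel₀ hlne ?_
    linear_combination h3
  · have h3 := congrArg (fun z => ⟪w, z⟫_ℂ) h2
    simp only [add_apply, smul_apply, ContinuousLinearMap.comp_apply, inner_add_right,
      inner_sub_right, inner_smul_right, ContinuousLinearMap.adjoint_inner_right] at h3
    simp only [map_sub, map_smul, inner_sub_right, inner_smul_right]
    linear_combination h3

end Resolvent

/-! ### The energy space and the generator -/

section Energy

theorem completeSpace_of_linearEquiv {Y H : Type*} [NormedAddCommGroup Y] [NormedSpace ℂ Y]
    [NormedAddCommGroup H] [NormedSpace ℂ H] [CompleteSpace H] (e : Y ≃ₗ[ℂ] H) {C K : ℝ}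
    (hC : ∀ y, ‖e y‖ ≤ C * ‖y‖) (hK : ∀ y, ‖y‖ ≤ K * ‖e y‖) : CompleteSpace Y := by
  let e' : Y ≃L[ℂ] H := e.toContinuousLinearEquivOfBounds C K hC fun z => by
    simpa using hK (e.symm z)
  exact e'.isUniformEmbedding.isUniformInducing.completeSpace_congr e'.surjective |>.2 ‹_›

/-- Completeness and the **Lumer–Phillips theorem** for an inner product given by a core that is
equivalent to a complete norm. -/
theorem complete_and_generates_of_core {Y H : Type*} [AddCommGroup Y] [Module ℂ Y]
    (core : InnerProductSpace.Core ℂ Y) [NormedAddCommGroup H] [NormedSpace ℂ H] [CompleteSpace H]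
    (e : Y ≃ₗ[ℂ] H) {k K : ℝ} (hk : 0 < k) (hk' : ∀ y, k * ‖e y‖ ^ 2 ≤ (core.inner y y).re)
    (hK : ∀ y, (core.inner y y).re ≤ K * ‖e y‖ ^ 2) {A : Y →ₗ.[ℂ] Y}
    (hdiss : ∀ x y, (x, y) ∈ A.graph → (core.inner x y).re ≤ 0)
    (hsurj : ∀ l : ℝ, 0 < l → ∀ z, ∃ x y, (x, y) ∈ A.graph ∧ (l : ℂ) • x - y = z) :
    letI : NormedAddCommGroup Y := core.toNormedAddCommGroup
    letI : InnerProductSpace ℂ Y := InnerProductSpace.ofCore core.toCore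
    CompleteSpace Y ∧ GeneratesContractionSemigroup A := by
  let _ : NormedAddCommGroup Y := core.toNormedAddCommGroup
  let _ : InnerProductSpace ℂ Y := InnerProductSpace.ofCore core.toCore
  have hn : ∀ y : Y, ‖y‖ ^ 2 = (core.inner y y).re := fun y =>
    (inner_self_eq_norm_sq (𝕜 := ℂ) y).symm
  have hcomp : CompleteSpace Y := by
    refine completeSpace_of_linearEquiv e (C := √(k⁻¹)) (K := √K) (fun y => ?_) fun y => ?_
    · refine abs_le_of_sq_le_sq' ?_ (by positivity) |>.2
      rw [mul_pow, Real.sq_sqrt (by positivity), hn, inv_mul_eq_div, le_div_iff₀ hk, mul_comm]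
      exact hk' y
    · -- a negative `K` is only possible if `Y` is trivial
      rcases le_or_gt 0 K with h0 | h0
      · refine abs_le_of_sq_le_sq' ?_ (by positivity) |>.2
        rw [mul_pow, Real.sq_sqrt h0, hn]
        exact hK y
      · have h1 := hK y
        rw [← hn] at h1
        have h2 : ‖y‖ ^ 2 ≤ 0 := h1.trans (mul_nonpos_of_nonpos_of_nonneg h0.le (sq_nonneg _))
        have h3 : ‖y‖ = 0 := by nlinarith [norm_nonneg y]
        rw [h3]
        positivity
  exact ⟨hcomp, generatesContractionSemigroup_of_dissipative hdiss fun l hl z => by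
    obtain ⟨x, y, hxy, h⟩ := hsurj l hl z
    exact ⟨x, y, hxy, h⟩⟩

variable {N : ℕ} {Ω : Opens (EuclideanSpace ℝ (Fin N))}

open closedTestGraph

theorem exists_energyEquiv : ∃ e : EnergySpace Ω ≃ₗ[ℂ] closedTestGraph Ω × L2 Ω × L2 Ω,
    ∀ U, val Ω (e U).1 = U.disp ∧ (e U).2.1 = U.vel ∧ (e U).2.2 = U.temp := by
  have hr : LinearMap.range (val Ω : closedTestGraph Ω →ₗ[ℂ] L2 Ω) = sobolevH10 Ω :=
    SetLike.coe_injective range_val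
  let e₁ : closedTestGraph Ω ≃ₗ[ℂ] sobolevH10 Ω :=
    (LinearEquiv.ofInjective (val Ω : closedTestGraph Ω →ₗ[ℂ] L2 Ω) val_injective).trans
      (LinearEquiv.ofEq _ _ hr)
  have h₁ : ∀ u, val Ω (e₁.symm u) = u := fun u =>
    congrArg Subtype.val (e₁.apply_symm_apply u)
  let e : (sobolevH10 Ω × L2 Ω × L2 Ω) ≃ₗ[ℂ] closedTestGraph Ω × L2 Ω × L2 Ω :=
    LinearEquiv.prodCongr e₁.symm (LinearEquiv.refl ℂ _)
  exact ⟨e, fun U => ⟨h₁ _, rfl, rfl⟩⟩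

variable {ε : ℝ} {a b : EuclideanSpace ℝ (Fin N) → Matrix (Fin N) (Fin N) ℝ}
  {c d γ : EuclideanSpace ℝ (Fin N) → ℝ}

theorem energyForm_eq {A : L2Vec Ω →L[ℂ] L2Vec Ω} {C D : L2 Ω →L[ℂ] L2 Ω}
    (hA : ∀ G, ∀ᵐ x ∂volume.restrict Ω, A G x = realMatrixCLM (a (ε⁻¹ • x)) (G x))
    (hC : ∀ u, ∀ᵐ x ∂volume.restrict Ω, C u x = (c (ε⁻¹ • x) : ℂ) * u x)
    (hD : ∀ u, ∀ᵐ x ∂volume.restrict Ω, D u x = (d (ε⁻¹ • x) : ℂ) * u x)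
    (U V : EnergySpace Ω) {u v : closedTestGraph Ω} (hu : val Ω u = U.disp)
    (hv : val Ω v = V.disp) :
    energyForm Ω ε a c d V U =
      ⟪nabla Ω u, A (nabla Ω v)⟫_ℂ + ⟪U.vel, C V.vel⟫_ℂ + ⟪U.temp, D V.temp⟫_ℂ := by
  rw [energyForm, ← hu, ← hv, grad_val, grad_val, MeasureTheory.L2.inner_def,
    MeasureTheory.L2.inner_def, MeasureTheory.L2.inner_def]
  congr 1
  · congr 1
    · refine integral_congr_ae ?_
      filter_upwards [hA (nabla Ω v)] with x hx
      rw [hx, inner_realMatrixCLM]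
    · refine integral_congr_ae ?_
      filter_upwards [hC V.vel] with x hx
      rw [hx, RCLike.inner_apply]
  · refine integral_congr_ae ?_
    filter_upwards [hD V.temp] with x hx
    rw [hx, RCLike.inner_apply]

theorem eq_inv_mul_sub_iff {k g v f t : ℂ} (hk : k ≠ 0) :
    v = -(1 / k) * f - g / k * t ↔ f = -(k * v + g * t) := by
  constructor
  · rintro rfl
    field_simp
    ring
  · rintro rfl
    field_simp
    ring

theorem eq_sub_inv_mul_iff {k g v f t : ℂ} (hk : k ≠ 0) :
    v = g / k * t - 1 / k * f ↔ f = g * t - k * v := by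
  constructor
  · rintro rfl
    field_simp
    ring
  · rintro rfl
    field_simp
    ring

/-- The graph of the thermoelastic operator in weak form, with the divisions by `c` and `d`
cleared. -/
theorem mem_thermoOp_graph_iff {A B : L2Vec Ω →L[ℂ] L2Vec Ω} {C D Γ : L2 Ω →L[ℂ] L2 Ω}
    (hA : ∀ G, ∀ᵐ x ∂volume.restrict Ω, A G x = realMatrixCLM (a (ε⁻¹ • x)) (G x))
    (hB : ∀ G, ∀ᵐ x ∂volume.restrict Ω, B G x = realMatrixCLM (b (ε⁻¹ • x)) (G x))
    (hC : ∀ u, ∀ᵐ x ∂volume.restrict Ω, C u x = (c (ε⁻¹ • x) : ℂ) * u x)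
    (hD : ∀ u, ∀ᵐ x ∂volume.restrict Ω, D u x = (d (ε⁻¹ • x) : ℂ) * u x)
    (hΓ : ∀ u, ∀ᵐ x ∂volume.restrict Ω, Γ u x = (γ (ε⁻¹ • x) : ℂ) * u x)
    (hc : ∀ᵐ x ∂volume.restrict Ω, c (ε⁻¹ • x) ≠ 0)
    (hd : ∀ᵐ x ∂volume.restrict Ω, d (ε⁻¹ • x) ≠ 0)
    (hsqrt : sqrtDomain (ellipticOp Ω ε a) = sobolevH10 Ω) (U F : EnergySpace Ω) :
    (U, F) ∈ (thermoOp Ω ε a b c d γ).graph ↔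
      F.disp = U.vel ∧ ∃ u v θ, val Ω u = U.disp ∧ val Ω v = U.vel ∧ val Ω θ = U.temp ∧
        (∀ w, ⟪nabla Ω w, A (nabla Ω u)⟫_ℂ = -⟪val Ω w, C F.vel + Γ U.temp⟫_ℂ) ∧
        ∀ w, ⟪nabla Ω w, B (nabla Ω θ)⟫_ℂ = ⟪val Ω w, Γ U.vel - D F.temp⟫_ℂ := by
  have hgraph : (thermoOp Ω ε a b c d γ).graph = thermoGraph Ω ε a b c d γ :=
    Submodule.toLinearPMap_graph_eq _ thermoGraph_unique
  have hmem : (U, F) ∈ (thermoOp Ω ε a b c d γ).graph ↔ ∃ Au Bθ : L2 Ω,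
      (U.disp, Au) ∈ (ellipticOp Ω ε a).graph ∧ U.vel ∈ sqrtDomain (ellipticOp Ω ε a) ∧
      (U.temp, Bθ) ∈ (ellipticOp Ω ε b).graph ∧ F.disp = U.vel ∧
      (∀ᵐ x ∂volume.restrict Ω, F.vel x =
        -(1 / (c (ε⁻¹ • x) : ℂ)) * Au x - (γ (ε⁻¹ • x) : ℂ) / (c (ε⁻¹ • x) : ℂ) * U.temp x) ∧
      (∀ᵐ x ∂volume.restrict Ω, F.temp x =
        (γ (ε⁻¹ • x) : ℂ) / (d (ε⁻¹ • x) : ℂ) * U.vel x - (1 / (d (ε⁻¹ • x) : ℂ)) * Bθ x) := by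
    rw [hgraph]; rfl
  have hneg : ∀ u : L2 Ω, ∀ᵐ x ∂volume.restrict Ω, (-u) x = - u x := fun u => by
    filter_upwards [Lp.coeFn_neg u] with x hx
    rw [hx]; rfl
  have hsub : ∀ u w : L2 Ω, ∀ᵐ x ∂volume.restrict Ω, (u - w) x = u x - w x := fun u w => by
    filter_upwards [Lp.coeFn_sub u w] with x hx
    rw [hx]; rfl
  have e1 : ∀ f : L2 Ω, (∀ᵐ x ∂volume.restrict Ω, F.vel x =
      -(1 / (c (ε⁻¹ • x) : ℂ)) * f x - (γ (ε⁻¹ • x) : ℂ) / (c (ε⁻¹ • x) : ℂ) * U.temp x) ↔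
      f = -(C F.vel + Γ U.temp) := by
    intro f
    have hval : ∀ᵐ x ∂volume.restrict Ω, (-(C F.vel + Γ U.temp)) x =
        -((c (ε⁻¹ • x) : ℂ) * F.vel x + (γ (ε⁻¹ • x) : ℂ) * U.temp x) := by
      filter_upwards [hneg (C F.vel + Γ U.temp), L2.add_ae (C F.vel) (Γ U.temp), hC F.vel,
        hΓ U.temp] with x h1 h2 h3 h4
      rw [h1, h2, h3, h4]
    constructor
    · intro h
      refine Lp.ext ?_
      filter_upwards [h, hval, hc] with x h1 h2 h3
      have h3' : (c (ε⁻¹ • x) : ℂ) ≠ 0 := by exact_mod_cast h3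
      exact ((eq_inv_mul_sub_iff h3').1 h1).trans h2.symm
    · rintro rfl
      filter_upwards [hval, hc] with x h2 h3
      have h3' : (c (ε⁻¹ • x) : ℂ) ≠ 0 := by exact_mod_cast h3
      exact (eq_inv_mul_sub_iff h3').2 h2
  have e2 : ∀ f : L2 Ω, (∀ᵐ x ∂volume.restrict Ω, F.temp x =
      (γ (ε⁻¹ • x) : ℂ) / (d (ε⁻¹ • x) : ℂ) * U.vel x - (1 / (d (ε⁻¹ • x) : ℂ)) * f x) ↔
      f = Γ U.vel - D F.temp := by
    intro f
    have hval : ∀ᵐ x ∂volume.restrict Ω, (Γ U.vel - D F.temp) x =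
        (γ (ε⁻¹ • x) : ℂ) * U.vel x - (d (ε⁻¹ • x) : ℂ) * F.temp x := by
      filter_upwards [hsub (Γ U.vel) (D F.temp), hD F.temp, hΓ U.vel] with x h1 h2 h3
      rw [h1, h2, h3]
    constructor
    · intro h
      refine Lp.ext ?_
      filter_upwards [h, hval, hd] with x h1 h2 h3
      have h3' : (d (ε⁻¹ • x) : ℂ) ≠ 0 := by exact_mod_cast h3
      exact ((eq_sub_inv_mul_iff h3').1 h1).trans h2.symm
    · rintro rfl
      filter_upwards [hval, hd] with x h2 h3
      have h3' : (d (ε⁻¹ • x) : ℂ) ≠ 0 := by exact_mod_cast h3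
      exact (eq_sub_inv_mul_iff h3').2 h2
  rw [hmem]
  simp only [e1, e2, mem_ellipticOp_graph_iff hA, mem_ellipticOp_graph_iff hB, hsqrt]
  constructor
  · rintro ⟨f, h, ⟨u, hu, hu'⟩, hv, ⟨θ, hθ, hθ'⟩, hF, rfl, rfl⟩
    have hv' : U.vel ∈ Set.range (val Ω) := by rw [range_val]; exact hv
    obtain ⟨v, hv'⟩ := hv'
    exact ⟨hF, u, v, θ, hu, hv', hθ, fun w => by rw [hu', inner_neg_right], hθ'⟩
  · rintro ⟨hF, u, v, θ, hu, hv, hθ, hu', hθ'⟩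
    refine ⟨_, _, ⟨u, hu, fun w => by rw [hu', inner_neg_right]⟩, ?_, ⟨θ, hθ, hθ'⟩, hF, rfl, rfl⟩
    rw [← SetLike.mem_coe, ← range_val]
    exact ⟨v, hv⟩

end Energy

/-! ### Dissipativity and the range condition for the thermoelastic operator -/

section EnergyCore

theorem re_inner_clm_self_le {F : Type*} [NormedAddCommGroup F] [InnerProductSpace ℂ F]
    (T : F →L[ℂ] F) (u : F) : (⟪u, T u⟫_ℂ).re ≤ ‖T‖ * ‖u‖ ^ 2 := by
  refine (Complex.re_le_norm _).trans ((norm_inner_le_norm _ _).trans ?_)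
  have := T.le_opNorm u
  nlinarith [norm_nonneg u]

variable {Y X E V : Type*} [AddCommGroup Y] [Module ℂ Y] [NormedAddCommGroup X]
  [InnerProductSpace ℂ X] [NormedAddCommGroup E] [InnerProductSpace ℂ E]
  [NormedAddCommGroup V] [InnerProductSpace ℂ V]

/-- The energy form on `V × X × X`, where `g` plays the part of the gradient and `A`, `C`, `D` of
the coefficients, transported to `Y` by `e`. It is linear in the second argument. -/
def coupledForm (e : Y ≃ₗ[ℂ] V × X × X) (g : V →L[ℂ] E) (A : E →L[ℂ] E) (C D : X →L[ℂ] X)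
    (x y : Y) : ℂ :=
  ⟪g (e x).1, A (g (e y).1)⟫_ℂ + ⟪(e x).2.1, C (e y).2.1⟫_ℂ + ⟪(e x).2.2, D (e y).2.2⟫_ℂ

variable {e : Y ≃ₗ[ℂ] V × X × X} {g : V →L[ℂ] E} {A : E →L[ℂ] E} {C D : X →L[ℂ] X}

theorem re_coupledForm_self_ge {k α : ℝ} (hk : 0 ≤ k) (hkα : k ≤ α)
    (hA : ∀ v, k * ‖v‖ ^ 2 ≤ (⟪g v, A (g v)⟫_ℂ).re)
    (hC : ∀ u, α * ‖u‖ ^ 2 ≤ (⟪u, C u⟫_ℂ).re) (hD : ∀ u, α * ‖u‖ ^ 2 ≤ (⟪u, D u⟫_ℂ).re) (y : Y) :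
    k * ‖e y‖ ^ 2 ≤ (coupledForm e g A C D y y).re := by
  have h1 := hA (e y).1
  have h2 := (mul_le_mul_of_nonneg_right hkα (sq_nonneg _)).trans (hC (e y).2.1)
  have h3 := (mul_le_mul_of_nonneg_right hkα (sq_nonneg _)).trans (hD (e y).2.2)
  have n1 := mul_nonneg hk (sq_nonneg ‖(e y).1‖)
  have n2 := mul_nonneg hk (sq_nonneg ‖(e y).2.1‖)
  have n3 := mul_nonneg hk (sq_nonneg ‖(e y).2.2‖)
  rw [coupledForm, Complex.add_re, Complex.add_re, Prod.norm_def, Prod.norm_def]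
  rcases max_choice ‖(e y).1‖ (max ‖(e y).2.1‖ ‖(e y).2.2‖) with h | h
  · rw [h]; linarith
  · rw [h]
    rcases max_choice ‖(e y).2.1‖ ‖(e y).2.2‖ with h | h
    · rw [h]; linarith
    · rw [h]; linarith

theorem re_coupledForm_self_le (y : Y) :
    (coupledForm e g A C D y y).re ≤ (‖g‖ * ‖A‖ * ‖g‖ + ‖C‖ + ‖D‖) * ‖e y‖ ^ 2 := by
  have h1 := re_inner_clm_self_le A (g (e y).1)
  have h2 := re_inner_clm_self_le C (e y).2.1
  have h3 := re_inner_clm_self_le D (e y).2.2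
  have n1 : ‖(e y).1‖ ≤ ‖e y‖ := norm_fst_le _
  have n2 : ‖(e y).2.1‖ ≤ ‖e y‖ := (norm_fst_le (e y).2).trans (norm_snd_le _)
  have n3 : ‖(e y).2.2‖ ≤ ‖e y‖ := (norm_snd_le (e y).2).trans (norm_snd_le _)
  have m1 : ‖A‖ * ‖g (e y).1‖ ^ 2 ≤ ‖A‖ * (‖g‖ * ‖e y‖) ^ 2 := by
    have := (g.le_opNorm (e y).1).trans (mul_le_mul_of_nonneg_left n1 (norm_nonneg g))
    gcongr
  have m2 : ‖C‖ * ‖(e y).2.1‖ ^ 2 ≤ ‖C‖ * ‖e y‖ ^ 2 := by gcongr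
  have m3 : ‖D‖ * ‖(e y).2.2‖ ^ 2 ≤ ‖D‖ * ‖e y‖ ^ 2 := by gcongr
  rw [coupledForm, Complex.add_re, Complex.add_re]
  linarith

theorem exists_core_coupledForm {k : ℝ} (hk : 0 < k)
    (hco : ∀ y, k * ‖e y‖ ^ 2 ≤ (coupledForm e g A C D y y).re)
    (hA : ∀ G H, ⟪A G, H⟫_ℂ = ⟪G, A H⟫_ℂ) (hC : ∀ u w, ⟪C u, w⟫_ℂ = ⟪u, C w⟫_ℂ)
    (hD : ∀ u w, ⟪D u, w⟫_ℂ = ⟪u, D w⟫_ℂ) :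
    ∃ core : InnerProductSpace.Core ℂ Y, ∀ x y, core.inner x y = coupledForm e g A C D x y := by
  refine ⟨{ inner := coupledForm e g A C D, conj_inner_symm := fun x y => ?_,
            re_inner_nonneg := fun x => ?_, add_left := fun x y z => ?_,
            smul_left := fun x y r => ?_, definite := fun x hx => ?_ }, fun x y => rfl⟩
  · simp only [coupledForm, map_add, inner_conj_symm, hA, hC, hD]
  · exact (by positivity : 0 ≤ k * ‖e x‖ ^ 2).trans (hco x)
  · simp only [coupledForm, map_add, Prod.fst_add, Prod.snd_add, inner_add_left]
    ring
  · simp only [coupledForm, map_smul, Prod.smul_fst, Prod.smul_snd, inner_smul_left]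
    ring
  · have h1 := hco x
    rw [show coupledForm e g A C D x x = 0 from hx, Complex.zero_re] at h1
    have h2 : ‖e x‖ ^ 2 ≤ 0 := by
      by_contra hc
      push Not at hc
      linarith [mul_pos hk hc]
    have h3 : ‖e x‖ = 0 := by nlinarith [norm_nonneg (e x)]
    exact e.map_eq_zero_iff.1 (norm_eq_zero.1 h3)

/-- Energy dissipation: along the thermoelastic system the coupling terms and the elastic terms
cancel, and only the heat conduction `-⟪g θ, B (g θ)⟫` is left. -/
theorem re_energy_rate_nonpos {p : V →L[ℂ] X} {B : E →L[ℂ] E} {Γ : X →L[ℂ] X} {α : ℝ}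
    (hA : ∀ G H, ⟪A G, H⟫_ℂ = ⟪G, A H⟫_ℂ) (hB : ∀ G, α * ‖G‖ ^ 2 ≤ (⟪B G, G⟫_ℂ).re)
    (hα : 0 ≤ α) (hΓ : ∀ u w, ⟪Γ u, w⟫_ℂ = ⟪u, Γ w⟫_ℂ) {u v θ : V} {q h : X}
    (h1 : ⟪g v, A (g u)⟫_ℂ = -⟪p v, q + Γ (p θ)⟫_ℂ)
    (h2 : ⟪g θ, B (g θ)⟫_ℂ = ⟪p θ, Γ (p v) - h⟫_ℂ) :
    (⟪g u, A (g v)⟫_ℂ + ⟪p v, q⟫_ℂ + ⟪p θ, h⟫_ℂ).re ≤ 0 := by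
  rw [inner_add_right] at h1
  rw [inner_sub_right] at h2
  have r1 : (⟪g u, A (g v)⟫_ℂ).re = (⟪g v, A (g u)⟫_ℂ).re := by
    rw [← hA, ← inner_conj_symm, Complex.conj_re]
  have r2 : (⟪p v, Γ (p θ)⟫_ℂ).re = (⟪p θ, Γ (p v)⟫_ℂ).re := by
    rw [← hΓ, ← inner_conj_symm, Complex.conj_re]
  have r3 : 0 ≤ (⟪g θ, B (g θ)⟫_ℂ).re := by
    rw [← inner_conj_symm, Complex.conj_re]
    exact (by positivity : 0 ≤ α * ‖g θ‖ ^ 2).trans (hB _)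
  have s1 := congrArg Complex.re h1
  have s2 := congrArg Complex.re h2
  rw [Complex.neg_re, Complex.add_re] at s1
  rw [Complex.sub_re] at s2
  rw [Complex.add_re, Complex.add_re]
  linarith

end EnergyCore

open closedTestGraph

/-- The domain of the square root of the Dirichlet operator `-div(a(·/ε)∇·)` is `H¹₀(Ω)`. -/
theorem IsEllipticCoeff.sqrtDomain_ellipticOp {N : ℕ} (hN : 0 < N)
    {Ω : Opens (EuclideanSpace ℝ (Fin N))}
    (hΩ : Bornology.IsBounded (Ω : Set (EuclideanSpace ℝ (Fin N)))) {α : ℝ} (hα : 0 < α)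
    {a : EuclideanSpace ℝ (Fin N) → Matrix (Fin N) (Fin N) ℝ} (ha : IsEllipticCoeff α a)
    {ε : ℝ} (hε : 0 < ε) : sqrtDomain (ellipticOp Ω ε a) = sobolevH10 Ω := by
  obtain ⟨A, hA, hAs, hAc⟩ := ha.exists_operator Ω hα hε
  obtain ⟨P, hP0, hP⟩ := exists_poincare hN hΩ
  refine SetLike.coe_injective ((sqrtDomain_eq_range val_injective denseRange_val
    (T := ContinuousLinearMap.adjoint (nabla Ω) ∘L A ∘L nabla Ω) (fun v w => ?_)
    (by positivity : 0 < α / (P + 1))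
    (coercive_of_poincare (norm_sq (Ω := Ω)) hP0 hP hα hAc) fun u f => ?_).trans range_val)
  · simp only [ContinuousLinearMap.comp_apply, ContinuousLinearMap.adjoint_inner_left,
      ContinuousLinearMap.adjoint_inner_right, hAs]
  · rw [mem_ellipticOp_graph_iff hA]
    simp only [ContinuousLinearMap.comp_apply, comp_adjoint_eq_iff]

/-- The range condition for the thermoelastic operator. -/
theorem exists_resolvent_thermoOp {N : ℕ} {Ω : Opens (EuclideanSpace ℝ (Fin N))} {P : ℝ}
    (hP0 : 0 ≤ P) (hP : ∀ u : closedTestGraph Ω, ‖val Ω u‖ ^ 2 ≤ P * ‖nabla Ω u‖ ^ 2) {α : ℝ}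
    (hα : 0 < α) {ε : ℝ} {a b : EuclideanSpace ℝ (Fin N) → Matrix (Fin N) (Fin N) ℝ}
    {c d γ : EuclideanSpace ℝ (Fin N) → ℝ}
    {A B : L2Vec Ω →L[ℂ] L2Vec Ω} {C D Γ : L2 Ω →L[ℂ] L2 Ω}
    (hA : ∀ G, ∀ᵐ x ∂volume.restrict Ω, A G x = realMatrixCLM (a (ε⁻¹ • x)) (G x))
    (hB : ∀ G, ∀ᵐ x ∂volume.restrict Ω, B G x = realMatrixCLM (b (ε⁻¹ • x)) (G x))
    (hC : ∀ u, ∀ᵐ x ∂volume.restrict Ω, C u x = (c (ε⁻¹ • x) : ℂ) * u x)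
    (hD : ∀ u, ∀ᵐ x ∂volume.restrict Ω, D u x = (d (ε⁻¹ • x) : ℂ) * u x)
    (hΓ : ∀ u, ∀ᵐ x ∂volume.restrict Ω, Γ u x = (γ (ε⁻¹ • x) : ℂ) * u x)
    (hAc : ∀ G, α * ‖G‖ ^ 2 ≤ (⟪A G, G⟫_ℂ).re) (hBc : ∀ G, α * ‖G‖ ^ 2 ≤ (⟪B G, G⟫_ℂ).re)
    (hCc : ∀ u, α * ‖u‖ ^ 2 ≤ (⟪C u, u⟫_ℂ).re) (hDc : ∀ u, α * ‖u‖ ^ 2 ≤ (⟪D u, u⟫_ℂ).re)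
    (hΓs : ∀ u w, ⟪Γ u, w⟫_ℂ = ⟪u, Γ w⟫_ℂ)
    (hc : ∀ᵐ x ∂volume.restrict Ω, c (ε⁻¹ • x) ≠ 0)
    (hd : ∀ᵐ x ∂volume.restrict Ω, d (ε⁻¹ • x) ≠ 0)
    (hsqrt : sqrtDomain (ellipticOp Ω ε a) = sobolevH10 Ω) {l : ℝ} (hl : 0 < l)
    (Z : EnergySpace Ω) :
    ∃ U F, (U, F) ∈ (thermoOp Ω ε a b c d γ).graph ∧ (l : ℂ) • U - F = Z := by
  obtain ⟨e, he⟩ := exists_energyEquiv (Ω := Ω)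
  obtain ⟨u, v, θ, h1, h2, h3⟩ := exists_weak_resolvent (norm_sq (Ω := Ω)) hP0 hP hα hAc hBc hCc
    hDc hΓs hl (e Z).1 Z.vel Z.temp
  obtain ⟨U, hU⟩ := e.surjective (u, val Ω v, val Ω θ)
  obtain ⟨hU1, hU2, hU3⟩ := he U
  rw [hU] at hU1 hU2 hU3
  refine ⟨U, (l : ℂ) • U - Z, ?_, sub_sub_cancel _ _⟩
  rw [mem_thermoOp_graph_iff hA hB hC hD hΓ hc hd hsqrt]
  have hZ : (l : ℂ) • val Ω u - val Ω v = Z.disp := by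
    rw [← map_smul, ← map_sub, h1, (he Z).1]
  have e1 : ((l : ℂ) • U - Z).disp = val Ω v := by
    rw [map_sub, map_smul, ← hU1, ← hZ, sub_sub_cancel]
  have e2 : ((l : ℂ) • U - Z).vel = (l : ℂ) • val Ω v - Z.vel := by
    rw [map_sub, map_smul, ← hU2]
  have e3 : ((l : ℂ) • U - Z).temp = (l : ℂ) • val Ω θ - Z.temp := by
    rw [map_sub, map_smul, ← hU3]
  refine ⟨e1.trans hU2, u, v, θ, hU1, hU2, hU3, fun w => ?_, fun w => ?_⟩
  · rw [h2, e2, ← hU3]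
  · rw [h3, e3, ← hU2]

theorem theorem4p1 {N : ℕ} (hN : 0 < N) (Ω : Opens (EuclideanSpace ℝ (Fin N)))
    (hΩ : Bornology.IsBounded (Ω : Set (EuclideanSpace ℝ (Fin N))))
    (α : ℝ) (hα : 0 < α)
    (a b : EuclideanSpace ℝ (Fin N) → Matrix (Fin N) (Fin N) ℝ)
    (c d γ : EuclideanSpace ℝ (Fin N) → ℝ)
    (ha : IsEllipticCoeff α a) (hb : IsEllipticCoeff α b)
    (hc : IsDensityCoeff α c) (hd : IsDensityCoeff α d) (hγ : IsCouplingCoeff γ)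
    (ε : ℝ) (hε : 0 < ε) :
    sqrtDomain (ellipticOp Ω ε a) = sobolevH10 Ω ∧
    ∃ core : InnerProductSpace.Core ℂ (EnergySpace Ω),
      (∀ U V, core.inner U V = energyForm Ω ε a c d V U) ∧
      letI : NormedAddCommGroup (EnergySpace Ω) := core.toNormedAddCommGroup
      letI : InnerProductSpace ℂ (EnergySpace Ω) := InnerProductSpace.ofCore core.toCore
      CompleteSpace (EnergySpace Ω) ∧
        GeneratesContractionSemigroup (thermoOp Ω ε a b c d γ) := by
  obtain ⟨A, hA, hAs, hAc⟩ := ha.exists_operator Ω hα hε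
  obtain ⟨B, hB, -, hBc⟩ := hb.exists_operator Ω hα hε
  obtain ⟨C, hC, hCs, hCc⟩ := exists_scalar_operator Ω hc.measurable hc.periodic hα.le hc.bounds hε
  obtain ⟨D, hD, hDs, hDc⟩ := exists_scalar_operator Ω hd.measurable hd.periodic hα.le hd.bounds hε
  obtain ⟨Γ, hΓ, hΓs, -⟩ := exists_scalar_operator Ω hγ.measurable hγ.periodic le_rfl
    (hγ.bounds.mono fun y hy => (⟨hy.1.le, hy.2.le⟩ : 0 ≤ γ y ∧ γ y ≤ 1)) hε
  have hc0 : ∀ᵐ x ∂volume.restrict Ω, c (ε⁻¹ • x) ≠ 0 :=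
    hc.periodic.ae_rescaled (P := fun r => r ≠ 0)
      (hc.bounds.mono fun y hy => (hα.trans_le hy.1).ne') hε Ω
  have hd0 : ∀ᵐ x ∂volume.restrict Ω, d (ε⁻¹ • x) ≠ 0 :=
    hd.periodic.ae_rescaled (P := fun r => r ≠ 0)
      (hd.bounds.mono fun y hy => (hα.trans_le hy.1).ne') hε Ω
  obtain ⟨P, hP0, hP⟩ := exists_poincare hN hΩ
  have hkpos : 0 < α / (P + 1) := by positivity
  have hco := coercive_of_poincare (norm_sq (Ω := Ω)) hP0 hP hα hAc
  have hsqrt := ha.sqrtDomain_ellipticOp hN hΩ hα hε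
  refine ⟨hsqrt, ?_⟩
  obtain ⟨e, he⟩ := exists_energyEquiv (Ω := Ω)
  have hform : ∀ U V, energyForm Ω ε a c d V U = coupledForm e (nabla Ω) A C D U V := by
    intro U V
    rw [energyForm_eq hA hC hD U V (he U).1 (he V).1, coupledForm, (he U).2.1, (he U).2.2,
      (he V).2.1, (he V).2.2]
  have hlower := re_coupledForm_self_ge (e := e) (C := C) (D := D) hkpos.le
    (div_le_self hα.le (by linarith : 1 ≤ P + 1))
    (fun v => by
      have h := hco v
      rwa [ContinuousLinearMap.adjoint_inner_left, hAs] at h)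
    (fun u => by rw [← hCs]; exact hCc u) (fun u => by rw [← hDs]; exact hDc u)
  obtain ⟨core, hcore⟩ := exists_core_coupledForm hkpos hlower hAs hCs hDs
  refine ⟨core, fun U V => (hcore U V).trans (hform U V).symm, ?_⟩
  refine complete_and_generates_of_core core e (K := ‖nabla Ω‖ * ‖A‖ * ‖nabla Ω‖ + ‖C‖ + ‖D‖)
    hkpos (fun y => ?_) (fun y => ?_)
    (fun U F hUF => ?_) fun l hl Z => ?_
  · rw [hcore]; exact hlower y
  · rw [hcore]; exact re_coupledForm_self_le y
  · obtain ⟨hF, u, v, θ, hu, hv, hθ, hu', hθ'⟩ :=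
      (mem_thermoOp_graph_iff hA hB hC hD hΓ hc0 hd0 hsqrt U F).1 hUF
    rw [hcore, ← hform, energyForm_eq hA hC hD U F hu (hv.trans hF.symm), ← hv, ← hθ]
    refine re_energy_rate_nonpos hAs hBc hα.le hΓs ?_ ?_
    · rw [hu', hθ]
    · rw [hθ', hv]
  · exact exists_resolvent_thermoOp hP0 hP hα hA hB hC hD hΓ hAc hBc hCc hDc hΓs hc0 hd0 hsqrt hl Z

end
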